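/- Let $\mathbb D$ and $\mathbb T$ be the open unit disc and the unit circle in $\mathbb C$, and let $\mu$ be a finite positive Borel measure on $\overline{\mathbb D}$. For $w\in\mathbb D$ put $$U_\mu(w)=\int_{\mathbb D}\log\left|\frac{1-\overline\zeta w}{w-\zeta}\right|^2\frac{d\mu(\zeta)}{1-|\zeta|^2}+\int_{\mathbb T}\frac{1-|w|^2}{|\zeta-w|^2}\,d\mu(\zeta)\in[0,\infty],$$ and let $\mathcal D(\mu)$ be the space of all holomorphic functions $f$ on $\mathbb D$ with $$\mathcal D_\mu(f)=\int_{\mathbb D}|f'(z)|^2U_\mu(z)\,dA(z)<\infty,$$ where $dA$ is the normalized Lebesgue area measure on $\mathbb D$. Then $\mathcal D(\mu)$ has the Gleason property: for every $h\in\mathcal D(\mu)$ and every $\lambda\in\mathbb D$ there is $g\in\mathcal D(\mu)$ such that $$h(z)-h(\lambda)=(z-\lambda)g(z)\qquad\text{for all } z\in\mathbb D.$$ The space $\mathcal D(\mu)\cap H^2(\mathbb D)$ (which is $\mathcal D(\mu)$ itself when $\mu\neq0$, and the Hardy space $H^2(\mathbb D)$ when $\mu=0$) has the Gleason property as well. 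-/

import Mathlib

open MeasureTheory Metric Set
open scoped ENNReal ComplexConjugate

noncomputable section

/-- The kernel `log |(1 - conj ζ w) / (w - ζ)|² / (1 - |ζ|²)` for `ζ, w` in the open unit disc,
with its value `+∞` on the diagonal. -/
def greenKernel (ζ w : ℂ) : ℝ≥0∞ :=
  open Classical in
  if w = ζ then ⊤
  else ENNReal.ofReal
    (Real.log (‖(1 - conj ζ * w) / (w - ζ)‖ ^ 2) / (1 - ‖ζ‖ ^ 2))

/-- The kernel `(1 - |w|²) / |ζ - w|²` for `ζ` on the unit circle and `w` in the open disc. -/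
def poissonWeight (ζ w : ℂ) : ℝ≥0∞ :=
  ENNReal.ofReal ((1 - ‖w‖ ^ 2) / ‖ζ - w‖ ^ 2)

/-- The superharmonic weight `U_μ` (with values in `[0, ∞]`) of a Borel measure on the closed
unit disc. -/
def superharmonicWeight (μ : Measure (closedBall (0 : ℂ) 1)) (w : ℂ) : ℝ≥0∞ :=
  (∫⁻ ζ in {ζ : closedBall (0 : ℂ) 1 | ‖(ζ : ℂ)‖ < 1}, greenKernel ζ w ∂μ) +
    ∫⁻ ζ in {ζ : closedBall (0 : ℂ) 1 | ‖(ζ : ℂ)‖ = 1}, poissonWeight ζ w ∂μ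

/-- Lebesgue area measure on the open unit disc, normalized to have total mass one. -/
def normalizedArea : Measure ℂ :=
  (ENNReal.ofReal Real.pi)⁻¹ • (volume : Measure ℂ).restrict (ball (0 : ℂ) 1)

/-- The weighted Dirichlet integral `D_μ(f) = ∫_𝔻 |f'|² U_μ dA`, in `[0, ∞]`. -/
def dirichletIntegral (μ : Measure (closedBall (0 : ℂ) 1)) (f : ℂ → ℂ) : ℝ≥0∞ :=
  ∫⁻ z, ‖deriv f z‖ₑ ^ 2 * superharmonicWeight μ z ∂normalizedArea

/-- The Dirichlet-type space `D(μ)`: the functions that are holomorphic on the open unit disc and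
have finite weighted Dirichlet integral. Values outside the open disc play no role. -/
def dirichletSpace (μ : Measure (closedBall (0 : ℂ) 1)) : Set (ℂ → ℂ) :=
  {f | DifferentiableOn ℂ f (ball (0 : ℂ) 1) ∧ dirichletIntegral μ f < ⊤}

/-- The Hardy space `H²` of the open unit disc. -/
def hardySpace : Set (ℂ → ℂ) :=
  {f | DifferentiableOn ℂ f (ball (0 : ℂ) 1) ∧
    (⨆ r ∈ Ioo (0 : ℝ) 1, (ENNReal.ofReal (2 * Real.pi))⁻¹ *
      ∫⁻ θ in Ioc (0 : ℝ) (2 * Real.pi), ‖f (r * Complex.exp (θ * Complex.I))‖ₑ ^ 2) < ⊤}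

/-- A set `H` of functions on the open unit disc has the Gleason property if for all `h ∈ H` and
all `a` in the disc, `h - h(a) = (z - a) g` on the disc for some `g ∈ H`. -/
def HasGleasonProperty (H : Set (ℂ → ℂ)) : Prop :=
  ∀ h ∈ H, ∀ a ∈ ball (0 : ℂ) 1, ∃ g ∈ H,
    ∀ z ∈ ball (0 : ℂ) 1, h z - h a = (z - a) * g z

end

/-! The quotient g = `dslope h a` is holomorphic, and away from a the identity h' = g + (z - a) g'
gives |g'| ≲ |h'| + |h| + 1; near a, compactness bounds g and g'. So everything reduces to the
weighted Poincaré statement that ∫|h|² U_μ is finite whenever ∫|h'|² U_μ is. Since U_μ is a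
superposition of kernels, Tonelli reduces this in turn to one inequality for each pole ζ, with a
constant independent of ζ; that uniformity is the whole difficulty.

The inequality is proved for k_ζ(w) = (1 - |w|²)/|1 - conj ζ w|² with |ζ| < 1
(`exists_lintegral_sq_mul_diskKernel_le`). Contract w towards ζ along t ↦ ζ + t²(w - ζ), stopping at
t₀² = (1 - |ζ|)/4. Convexity of |·|² shows that k_ζ grows along the contraction
(`sq_mul_diskKernel_le_dilation`), by just enough that the speed factor, the kernel factor and the
planar Jacobian t⁻⁴ cancel (`lintegral_segmentVariation_sq_le`). All endpoints land in a
hyperbolically bounded disc around ζ, where the mean value inequality controls the oscillation of h.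
Descending from w, crossing that disc and climbing to a well-chosen point w₀ of the disc of radius
1/2 bounds h(w), and k_ζ has uniformly bounded area integral.

The two kernels of U_μ follow. The Poisson kernel is the limit of k_{rζ} as r → 1, treated by Fatou.
The Green kernel dominates k_ζ, is comparable to it away from the pole, and near the pole has an
integrable singularity against which |h|² is bounded by the mean value inequality.

For H², the pointwise bound |g| ≲ |h| + 1 suffices, and the same g serves for the intersection. -/

/-! ### Area integrals: the 1/|x| singularity, mean values, dilations -/

theorem lintegral_ball_inv_norm_le (c : ℂ) (ρ : ℝ) (hρ : 0 ≤ ρ) :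
    ∫⁻ x in ball c ρ, ENNReal.ofReal (‖x - c‖⁻¹) ≤ ENNReal.ofReal (2 * Real.pi * ρ) := by
  have h1 : ∫⁻ x in ball c ρ, ENNReal.ofReal (‖x - c‖⁻¹)
      = ∫⁻ x, (ball (0 : ℂ) ρ).indicator (fun x => ENNReal.ofReal (‖x‖⁻¹)) x := by
    rw [← lintegral_indicator measurableSet_ball,
      ← lintegral_sub_right_eq_self (μ := volume)
        (fun x => (ball (0 : ℂ) ρ).indicator (fun x => ENNReal.ofReal (‖x‖⁻¹)) x) c]
    congr 1 with x
    simp only [indicator, mem_ball, dist_eq_norm, sub_zero]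
  rw [h1, ← Complex.lintegral_comp_polarCoord_symm]
  calc _ ≤ ∫⁻ p in polarCoord.target, (Ioo 0 ρ ×ˢ Ioo (-Real.pi) Real.pi).indicator 1 p := by
        refine setLIntegral_mono' polarCoord.open_target.measurableSet fun p hp => ?_
        have hp1 : 0 < p.1 := hp.1
        have hp2 : ‖Complex.polarCoord.symm p‖ = p.1 := by
          rw [Complex.norm_polarCoord_symm, abs_of_pos hp1]
        by_cases hb : p.1 < ρ
        · rw [indicator_of_mem (by rw [mem_ball, dist_zero_right, hp2]; exact hb),
            indicator_of_mem (show p ∈ Ioo 0 ρ ×ˢ Ioo (-Real.pi) Real.pi from ⟨⟨hp1, hb⟩, hp.2⟩),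
            hp2, smul_eq_mul, ← ENNReal.ofReal_mul hp1.le, mul_inv_cancel₀ hp1.ne']
          simp
        · rw [indicator_of_notMem (by rw [mem_ball, dist_zero_right, hp2]; exact hb)]
          simp
    _ ≤ ∫⁻ p, (Ioo 0 ρ ×ˢ Ioo (-Real.pi) Real.pi).indicator 1 p := setLIntegral_le_lintegral _ _
    _ = _ := by
        rw [lintegral_indicator_one (measurableSet_Ioo.prod measurableSet_Ioo),
          Measure.volume_eq_prod, Measure.prod_prod, Real.volume_Ioo, Real.volume_Ioo,
          ← ENNReal.ofReal_mul (by simpa using hρ)]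
        congr 1; ring

theorem sq_lintegral_le {α : Type*} [MeasurableSpace α] (μ : Measure α) {F : α → ℝ≥0∞}
    (hF : AEMeasurable F μ) :
    (∫⁻ x, F x ∂μ) ^ 2 ≤ μ univ * ∫⁻ x, F x ^ 2 ∂μ := by
  have h := ENNReal.lintegral_mul_le_Lp_mul_Lq μ Real.HolderConjugate.two_two
    (aemeasurable_const (b := (1 : ℝ≥0∞))) hF
  simp only [Pi.mul_apply, one_mul, ENNReal.one_rpow, lintegral_const] at h
  calc _ ≤ (μ univ ^ (1 / 2 : ℝ) * (∫⁻ x, F x ^ (2 : ℝ) ∂μ) ^ (1 / 2 : ℝ)) ^ 2 := by gcongr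
    _ = _ := by
      rw [mul_pow, ← ENNReal.rpow_natCast, ← ENNReal.rpow_natCast, ← ENNReal.rpow_mul,
        ← ENNReal.rpow_mul]
      norm_num

/-- Mean value inequality on circles. -/
theorem enorm_sq_le_lintegral_rotation {f : ℂ → ℂ} {z x : ℂ} {r : ℝ}
    (hf : DifferentiableOn ℂ f (ball z r)) (hx : ‖x‖ < r) :
    ENNReal.ofReal (2 * Real.pi) * ‖f z‖ₑ ^ 2 ≤
      ∫⁻ θ in Ioc (0 : ℝ) (2 * Real.pi), ‖f (z + Complex.exp (θ * Complex.I) * x)‖ₑ ^ 2 := by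
  have hm : ∀ u ∈ closedBall (0 : ℂ) 1, z + u * x ∈ ball z r := by
    intro u hu
    simp only [mem_closedBall, dist_zero_right] at hu
    simp only [mem_ball, dist_eq_norm, add_sub_cancel_left, norm_mul]
    nlinarith [norm_nonneg x]
  -- Apply the mean value property to the holomorphic function f² and then take absolute values; no
  -- subharmonicity of |f|² is needed.
  have hd : DifferentiableOn ℂ (fun u : ℂ => f (z + u * x) ^ 2) (closedBall 0 1) :=
    (hf.comp (by fun_prop) hm).pow 2
  have hD : DiffContOnCl ℂ (fun u : ℂ => f (z + u * x) ^ 2) (ball 0 |1|) := by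
    apply DifferentiableOn.diffContOnCl
    rw [abs_one, closure_ball _ one_ne_zero]
    exact hd
  have h := hD.circleAverage
  simp only [Real.circleAverage, zero_mul, add_zero, circleMap, Complex.ofReal_one, one_mul,
    zero_add] at h
  rw [inv_smul_eq_iff₀ (by positivity)] at h
  have h2 := congrArg enorm h
  rw [enorm_smul, enorm_pow, Real.enorm_of_nonneg (by positivity)] at h2
  rw [← h2, intervalIntegral.integral_of_le (by positivity)]
  refine (enorm_integral_le_lintegral_enorm _).trans (le_of_eq ?_)
  simp_rw [enorm_pow]

theorem measurable_indicator_of_continuousOn {α E : Type*} [TopologicalSpace α]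
    [MeasurableSpace α] [OpensMeasurableSpace α] [TopologicalSpace E] [MeasurableSpace E]
    [BorelSpace E] [Zero E] {f : α → E} {s : Set α} (hs : MeasurableSet s)
    (hf : ContinuousOn f s) : Measurable (s.indicator f) := by
  classical
  rw [← piecewise_eq_indicator]
  exact ContinuousOn.measurable_piecewise hf continuousOn_const hs

/-- Average the circle inequality over all x in the ball: rotations preserve area, so after Tonelli
the angular average does not change the integral. -/
theorem enorm_sq_mul_volume_ball_le {f : ℂ → ℂ} {z : ℂ} {r : ℝ}
    (hf : DifferentiableOn ℂ f (ball z r)) :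
    ‖f z‖ₑ ^ 2 * volume (ball z r) ≤ ∫⁻ x in ball z r, ‖f x‖ₑ ^ 2 := by
  set F : ℂ → ℝ≥0∞ := (ball (0 : ℂ) r).indicator (fun x => ‖f (z + x)‖ₑ ^ 2) with hF
  have hmeas : Measurable F := by
    have h1 : ContinuousOn (fun x : ℂ => f (z + x)) (ball 0 r) :=
      hf.continuousOn.comp (by fun_prop) fun x hx => by simpa using hx
    have h2 := (measurable_indicator_of_continuousOn measurableSet_ball h1).enorm.pow_const 2
    convert h2 using 2 with x
    by_cases hx : x ∈ ball (0 : ℂ) r <;> simp [hF, hx]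
  have h0 : ∫⁻ x in ball z r, ‖f x‖ₑ ^ 2 = ∫⁻ x, F x := by
    rw [← lintegral_indicator measurableSet_ball, ← lintegral_add_left_eq_self (μ := volume) _ z]
    congr 1 with x
    simp [hF, indicator]
  have hrot : ∀ θ : ℝ, ∫⁻ x, F (Complex.exp (θ * Complex.I) * x) = ∫⁻ x, F x := by
    intro θ
    have := (rotation (Circle.exp θ)).measurePreserving.lintegral_comp hmeas
    simpa [rotation_apply, Circle.coe_exp] using this
  have h1 : ENNReal.ofReal (2 * Real.pi) * ∫⁻ x, F x =
      ∫⁻ x, ∫⁻ θ in Ioc (0 : ℝ) (2 * Real.pi), F (Complex.exp (θ * Complex.I) * x) := by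
    rw [lintegral_lintegral_swap]
    · simp_rw [hrot]
      simp [mul_comm]
    · exact (hmeas.comp (by fun_prop)).aemeasurable
  have h2 : ENNReal.ofReal (2 * Real.pi) * (‖f z‖ₑ ^ 2 * volume (ball z r)) ≤
      ENNReal.ofReal (2 * Real.pi) * ∫⁻ x, F x := by
    rw [h1]
    have hv : volume (ball z r) = volume (ball (0 : ℂ) r) := by
      rw [Complex.volume_ball, Complex.volume_ball]
    rw [hv, ← mul_assoc, ← setLIntegral_const, ← lintegral_indicator measurableSet_ball]
    refine lintegral_mono fun x => ?_
    by_cases hx : x ∈ ball (0 : ℂ) r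
    · rw [indicator_of_mem hx]
      have hx' : ‖x‖ < r := by simpa using hx
      refine (enorm_sq_le_lintegral_rotation hf hx').trans (le_of_eq ?_)
      refine lintegral_congr fun θ => ?_
      rw [hF, indicator_of_mem]
      simpa [Complex.norm_exp_ofReal_mul_I] using hx'
    · rw [indicator_of_notMem hx]
      exact zero_le
  rw [h0]
  exact (ENNReal.mul_le_mul_iff_right (by simp [Real.pi_pos]) ENNReal.ofReal_ne_top).1 h2

theorem lintegral_comp_dilation (F : ℂ → ℝ≥0∞) (ζ : ℂ) {s : ℝ} (hs : 0 < s) :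
    ∫⁻ w, F (ζ + s * (w - ζ)) = ENNReal.ofReal ((s ^ 2)⁻¹) * ∫⁻ w, F w := by
  have h1 : ∫⁻ w, F (ζ + s * (w - ζ)) = ∫⁻ w, F (ζ + s • w) := by
    rw [← lintegral_sub_right_eq_self (μ := volume) (fun w => F (ζ + s • w)) ζ]
    simp
  have h2 : ∫⁻ w, F (ζ + s • w) = ENNReal.ofReal ((s ^ 2)⁻¹) * ∫⁻ w, F (ζ + w) := by
    have hm := Measure.map_addHaar_smul (volume : Measure ℂ) hs.ne'
    have := (Homeomorph.smulOfNeZero s hs.ne').measurableEmbedding.lintegral_map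
      (μ := (volume : Measure ℂ)) (fun w => F (ζ + w))
    simp only [Homeomorph.smulOfNeZero_apply] at this
    rw [← this]
    rw [hm, lintegral_smul_measure, Complex.finrank_real_complex, abs_of_pos (by positivity)]
    rfl
  rw [h1, h2, lintegral_add_left_eq_self]

/-- The quadratic parameter t² contributes a factor t to the speed. With a linear parameter s,
Cauchy–Schwarz and the later change of variables would leave ∫ ds/s, which is not bounded uniformly
as the pole approaches the circle. -/
theorem enorm_sub_le_lintegral_dilation {h : ℂ → ℂ} (hh : DifferentiableOn ℂ h (ball 0 1))
    {ζ w : ℂ} (hζ : ζ ∈ ball (0 : ℂ) 1) (hw : w ∈ ball (0 : ℂ) 1) {t₀ : ℝ} (h0 : 0 ≤ t₀)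
    (h1 : t₀ ≤ 1) :
    ‖h w - h (ζ + (t₀ ^ 2 : ℝ) * (w - ζ))‖ₑ ≤
      ∫⁻ t in Icc t₀ 1, ‖2 * t * (w - ζ) * deriv h (ζ + (t ^ 2 : ℝ) * (w - ζ))‖ₑ := by
  have hmem : ∀ t ∈ Icc t₀ 1, ζ + (t ^ 2 : ℝ) * (w - ζ) ∈ ball (0 : ℂ) 1 := by
    intro t ht
    have := (convex_ball (0 : ℂ) 1).add_smul_sub_mem hζ hw
      (t := t ^ 2) ⟨by positivity, by have := ht.1; have := ht.2; nlinarith⟩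
    simpa using this
  have hderiv : ∀ t ∈ Icc t₀ 1, HasDerivAt (fun t : ℝ => h (ζ + (t ^ 2 : ℝ) * (w - ζ)))
      (2 * t * (w - ζ) * deriv h (ζ + (t ^ 2 : ℝ) * (w - ζ))) t := by
    intro t ht
    have a1 : HasDerivAt (fun t : ℝ => ζ + ((t ^ 2 : ℝ) : ℂ) * (w - ζ)) (2 * t * (w - ζ)) t := by
      have b1 := (((hasDerivAt_id t).pow 2).ofReal_comp.mul_const (w - ζ)).const_add ζ
      refine HasDerivAt.congr_deriv b1 ?_
      simp
    have a2 := (hh.differentiableAt (isOpen_ball.mem_nhds (hmem t ht))).hasDerivAt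
    have := HasDerivAt.comp_of_eq t a2 a1 rfl
    refine this.congr_deriv (by ring)
  have hc : ContDiffOn ℝ 1 (fun t : ℝ => h (ζ + (t ^ 2 : ℝ) * (w - ζ))) (Icc t₀ 1) := by
    have a1 : ContDiffOn ℝ 1 h (ball 0 1) := (hh.contDiffOn isOpen_ball).restrict_scalars ℝ
    refine a1.comp (t := ball 0 1) ?_ hmem
    apply ContDiff.contDiffOn
    have : ContDiff ℝ 1 (fun t : ℝ => ((t ^ 2 : ℝ) : ℂ)) :=
      Complex.ofRealCLM.contDiff.comp (contDiff_id.pow 2)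
    exact contDiff_const.add (this.mul contDiff_const)
  have := enorm_sub_le_lintegral_deriv_of_contDiffOn_Icc hc h1
  simp only [one_pow, Complex.ofReal_one, one_mul, add_sub_cancel] at this
  refine this.trans (le_of_eq ?_)
  exact setLIntegral_congr_fun measurableSet_Icc fun t ht => by
    simp only [(hderiv t ht).deriv]

/-! ### Pointwise estimates for the disk kernel -/

/-- The kernel `(1 - |w|²) / |1 - conj ζ w|²`, comparable to `greenKernel` away from the diagonal
and equal to `poissonWeight` for `|ζ| = 1`. -/
noncomputable def diskKernel (ζ w : ℂ) : ℝ≥0∞ :=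
  ENNReal.ofReal ((1 - ‖w‖ ^ 2) / ‖1 - conj ζ * w‖ ^ 2)

theorem norm_one_sub_conj_mul_sq (ζ w : ℂ) :
    ‖1 - conj ζ * w‖ ^ 2 = ‖w - ζ‖ ^ 2 + (1 - ‖ζ‖ ^ 2) * (1 - ‖w‖ ^ 2) := by
  simp only [← Complex.normSq_eq_norm_sq, Complex.normSq_apply, Complex.sub_re, Complex.sub_im,
    Complex.mul_re, Complex.mul_im, Complex.conj_re, Complex.conj_im, Complex.one_re,
    Complex.one_im]
  ring

theorem norm_one_sub_conj_mul_pos {ζ w : ℂ} (hζ : ‖ζ‖ ≤ 1) (hw : ‖w‖ < 1) :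
    0 < ‖1 - conj ζ * w‖ := by
  rw [norm_pos_iff, sub_ne_zero]
  intro h
  have := congrArg norm h
  rw [norm_one, norm_mul, RCLike.norm_conj] at this
  nlinarith [norm_nonneg ζ, norm_nonneg w]

theorem norm_one_sub_conj_mul_le_two {ζ w : ℂ} (hζ : ‖ζ‖ ≤ 1) (hw : ‖w‖ ≤ 1) :
    ‖1 - conj ζ * w‖ ≤ 2 := by
  have h := norm_sub_le (1 : ℂ) (conj ζ * w)
  rw [norm_one, norm_mul, RCLike.norm_conj] at h
  nlinarith [norm_nonneg ζ, norm_nonneg w]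

theorem norm_sub_le_norm_one_sub_conj_mul {ζ w : ℂ} (hζ : ‖ζ‖ ≤ 1) (hw : ‖w‖ ≤ 1) :
    ‖w - ζ‖ ≤ ‖1 - conj ζ * w‖ := by
  refine le_of_sq_le_sq ?_ (norm_nonneg _)
  rw [norm_one_sub_conj_mul_sq]
  have h1 : 0 ≤ 1 - ‖ζ‖ ^ 2 := by nlinarith [norm_nonneg ζ]
  have h2 : 0 ≤ 1 - ‖w‖ ^ 2 := by nlinarith [norm_nonneg w]
  nlinarith [mul_nonneg h1 h2]

theorem norm_one_sub_conj_mul_le {ζ w : ℂ} (hζ : ‖ζ‖ ≤ 1) :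
    ‖1 - conj ζ * w‖ ≤ 2 * (1 - ‖ζ‖) + ‖w - ζ‖ := by
  have h1 : 1 - conj ζ * w = (1 - conj ζ * ζ) - conj ζ * (w - ζ) := by ring
  have h2 : ‖1 - conj ζ * ζ‖ = 1 - ‖ζ‖ ^ 2 := by
    rw [Complex.conj_mul', ← Complex.ofReal_pow, ← Complex.ofReal_one, ← Complex.ofReal_sub,
      Complex.norm_real, Real.norm_of_nonneg (by nlinarith [norm_nonneg ζ])]
  have h3 := norm_sub_le (1 - conj ζ * ζ) (conj ζ * (w - ζ))
  rw [← h1, h2, norm_mul, RCLike.norm_conj] at h3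
  nlinarith [norm_nonneg ζ, norm_nonneg (w - ζ)]

theorem measurable_diskKernel_right (ζ : ℂ) : Measurable (diskKernel ζ) := by
  unfold diskKernel
  fun_prop

theorem norm_dilation_sq_le (ζ w : ℂ) {s : ℝ} (h0 : 0 ≤ s) (h1 : s ≤ 1) :
    ‖ζ + s * (w - ζ)‖ ^ 2 ≤ (1 - s) * ‖ζ‖ ^ 2 + s * ‖w‖ ^ 2 := by
  have h : (1 - s) * ‖ζ‖ ^ 2 + s * ‖w‖ ^ 2 - ‖ζ + s * (w - ζ)‖ ^ 2 =
      s * (1 - s) * ‖w - ζ‖ ^ 2 := by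
    simp only [← Complex.normSq_eq_norm_sq, Complex.normSq_apply, Complex.sub_re, Complex.sub_im,
      Complex.mul_re, Complex.mul_im, Complex.add_re, Complex.add_im, Complex.ofReal_re,
      Complex.ofReal_im]
    ring
  have : 0 ≤ s * (1 - s) * ‖w - ζ‖ ^ 2 := by
    have : 0 ≤ 1 - s := by linarith
    positivity
  linarith

theorem norm_dilation_lt_one {ζ w : ℂ} (hζ : ‖ζ‖ < 1) (hw : ‖w‖ < 1) {s : ℝ} (h0 : 0 ≤ s)
    (h1 : s ≤ 1) : ‖ζ + s * (w - ζ)‖ < 1 := by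
  have h := (convex_ball (0 : ℂ) 1).add_smul_sub_mem (x := ζ) (y := w) (by simpa using hζ)
    (by simpa using hw) ⟨h0, h1⟩
  simpa using h

/-- Write z for the contracted point. Convexity gives 1 - |z|² ≥ s(1 - |w|²), while |1 - conj ζ z|
is at most of order s as long as s is not below the scale 1 - |ζ|; together these make the kernel at
z at least of order (1 - |w|²)/s. At w one uses only |w - ζ| ≤ |1 - conj ζ w|. -/
theorem sq_mul_diskKernel_le_dilation {ζ w : ℂ} (hζ : ‖ζ‖ < 1) (hw : ‖w‖ < 1) {s : ℝ}
    (h0 : (1 - ‖ζ‖) / 4 ≤ s) (h1 : s ≤ 1) :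
    ‖w - ζ‖ₑ ^ 2 * diskKernel ζ w ≤
      ENNReal.ofReal (100 * s) * diskKernel ζ (ζ + s * (w - ζ)) := by
  have hs : 0 < s := by linarith
  have hz := norm_dilation_lt_one hζ hw hs.le h1
  have hzsq := norm_dilation_sq_le ζ w hs.le h1
  set z := ζ + s * (w - ζ) with hzdef
  have hA := norm_one_sub_conj_mul_pos hζ.le hw
  have hAz := norm_one_sub_conj_mul_pos hζ.le hz
  have hvA := norm_sub_le_norm_one_sub_conj_mul hζ.le hw.le
  -- The lower bound on s turns 2(1 - |ζ|) into at most 8s, and |z - ζ| ≤ 2s supplies the rest.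
  have hz10 : ‖1 - conj ζ * z‖ ≤ 10 * s := by
    have e1 := norm_one_sub_conj_mul_le (w := z) hζ.le
    have e2 : ‖z - ζ‖ ≤ s * 2 := by
      rw [hzdef, add_sub_cancel_left, norm_mul, Complex.norm_real, Real.norm_of_nonneg hs.le]
      gcongr
      exact hvA.trans (norm_one_sub_conj_mul_le_two hζ.le hw.le)
    linarith
  have hD : 0 < 1 - ‖w‖ ^ 2 := by nlinarith [norm_nonneg w]
  have hζ2 : 0 < 1 - ‖ζ‖ ^ 2 := by nlinarith [norm_nonneg ζ]
  unfold diskKernel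
  rw [← ofReal_norm, ← ENNReal.ofReal_pow (norm_nonneg _),
    ← ENNReal.ofReal_mul (by positivity), ← ENNReal.ofReal_mul (by positivity)]
  apply ENNReal.ofReal_le_ofReal
  calc ‖w - ζ‖ ^ 2 * ((1 - ‖w‖ ^ 2) / ‖1 - conj ζ * w‖ ^ 2)
      = (‖w - ζ‖ / ‖1 - conj ζ * w‖) ^ 2 * (1 - ‖w‖ ^ 2) := by ring
    _ ≤ 1 ^ 2 * (1 - ‖w‖ ^ 2) := by
        gcongr
        exact (div_le_one hA).2 hvA
    _ = 100 * s * ((s * (1 - ‖w‖ ^ 2)) / (10 * s) ^ 2) := by field_simp; norm_num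
    _ ≤ 100 * s * ((1 - ‖z‖ ^ 2) / ‖1 - conj ζ * z‖ ^ 2) := by
        have : s * (1 - ‖w‖ ^ 2) ≤ 1 - ‖z‖ ^ 2 := by nlinarith
        have : 0 ≤ 1 - ‖z‖ ^ 2 := by nlinarith [norm_nonneg z]
        gcongr

theorem one_le_diskKernel_of_mem_ball {ζ w : ℂ} (hζ : ‖ζ‖ < 1)
    (hw : w ∈ ball ζ (3 / 4 * (1 - ‖ζ‖))) :
    1 ≤ ENNReal.ofReal (36 * (1 - ‖ζ‖)) * diskKernel ζ w := by
  rw [mem_ball, dist_eq_norm] at hw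
  have h1 := norm_add_le ζ (w - ζ)
  rw [add_sub_cancel] at h1
  have hw1 : ‖w‖ < 1 := by linarith
  have hA := norm_one_sub_conj_mul_pos hζ.le hw1
  have hA3 := norm_one_sub_conj_mul_le (w := w) hζ.le
  unfold diskKernel
  rw [← ENNReal.ofReal_mul (by linarith), ← ENNReal.ofReal_one]
  apply ENNReal.ofReal_le_ofReal
  rw [← mul_div_assoc, one_le_div (by positivity)]
  have h2 : ‖1 - conj ζ * w‖ ≤ 3 * (1 - ‖ζ‖) := by linarith
  have h3 : (1 - ‖ζ‖) / 4 ≤ 1 - ‖w‖ ^ 2 := by nlinarith [norm_nonneg w]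
  nlinarith

theorem one_le_diskKernel_of_mem_ball_zero {ζ w : ℂ} (hζ : ‖ζ‖ < 1)
    (hw : w ∈ ball (0 : ℂ) (1 / 2)) : 1 ≤ 8 * diskKernel ζ w := by
  rw [mem_ball, dist_zero_right] at hw
  have hA := norm_one_sub_conj_mul_pos hζ.le (by linarith : ‖w‖ < 1)
  have hA2 := norm_one_sub_conj_mul_le_two hζ.le (by linarith : ‖w‖ ≤ 1)
  unfold diskKernel
  rw [show (8 : ℝ≥0∞) = ENNReal.ofReal 8 by simp, ← ENNReal.ofReal_mul (by norm_num),
    ← ENNReal.ofReal_one]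
  apply ENNReal.ofReal_le_ofReal
  rw [← mul_div_assoc, one_le_div (by positivity)]
  nlinarith [norm_nonneg w]

/-- One factor |1 - conj ζ w| of the denominator absorbs 1 - |w|² ≤ 2(1 - |w|), the other dominates
|w - ζ|. This makes the area integral bounded uniformly in ζ. -/
theorem diskKernel_le_inv_norm {ζ w : ℂ} (hζ : ‖ζ‖ ≤ 1) (hw : ‖w‖ < 1) (hne : w ≠ ζ) :
    diskKernel ζ w ≤ 2 * ENNReal.ofReal (‖w - ζ‖⁻¹) := by
  have hv : 0 < ‖w - ζ‖ := norm_pos_iff.2 (sub_ne_zero.2 hne)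
  have hA := norm_one_sub_conj_mul_pos hζ hw
  have hvA := norm_sub_le_norm_one_sub_conj_mul hζ hw.le
  have h1 := norm_sub_norm_le (1 : ℂ) (conj ζ * w)
  rw [norm_one, norm_mul, RCLike.norm_conj] at h1
  unfold diskKernel
  rw [show (2 : ℝ≥0∞) = ENNReal.ofReal 2 by simp, ← ENNReal.ofReal_mul (by norm_num)]
  apply ENNReal.ofReal_le_ofReal
  calc _ ≤ (2 * ‖1 - conj ζ * w‖) / ‖1 - conj ζ * w‖ ^ 2 := by
        gcongr
        nlinarith [norm_nonneg w]
    _ = 2 * ‖1 - conj ζ * w‖⁻¹ := by field_simp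
    _ ≤ _ := by gcongr

theorem lintegral_diskKernel_le {ζ : ℂ} (hζ : ‖ζ‖ ≤ 1) :
    ∫⁻ w in ball 0 1, diskKernel ζ w ≤ ENNReal.ofReal (8 * Real.pi) := by
  calc _ ≤ ∫⁻ w in ball 0 1, 2 * ENNReal.ofReal (‖w - ζ‖⁻¹) := by
        refine lintegral_mono_ae ?_
        have h1 : ∀ᵐ w ∂(volume.restrict (ball (0 : ℂ) 1)), w ≠ ζ :=
          ae_restrict_of_ae (Measure.ae_ne volume ζ)
        filter_upwards [h1, ae_restrict_mem measurableSet_ball] with w h1 h2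
        exact diskKernel_le_inv_norm hζ (by simpa using h2) h1
    _ ≤ ∫⁻ w in ball ζ 2, 2 * ENNReal.ofReal (‖w - ζ‖⁻¹) := by
        refine lintegral_mono_set fun w hw => ?_
        rw [mem_ball, dist_zero_right] at hw
        rw [mem_ball, dist_eq_norm]
        linarith [norm_sub_le w ζ]
    _ ≤ 2 * ENNReal.ofReal (2 * Real.pi * 2) := by
        rw [lintegral_const_mul' _ _ (by simp)]
        gcongr
        exact lintegral_ball_inv_norm_le ζ 2 (by norm_num)
    _ = _ := by
        rw [show (2 : ℝ≥0∞) = ENNReal.ofReal 2 by simp, ← ENNReal.ofReal_mul (by norm_num)]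
        congr 1; ring

/-! ### Contraction towards the pole -/

/-- The total variation of `h` along the segment from `ζ + t₀² (w - ζ)` to `w`. -/
noncomputable def segmentVariation (h : ℂ → ℂ) (ζ : ℂ) (t₀ : ℝ) (w : ℂ) : ℝ≥0∞ :=
  ∫⁻ t in Icc t₀ 1, ‖2 * t * (w - ζ) * deriv h (ζ + (t ^ 2 : ℝ) * (w - ζ))‖ₑ

theorem measurable_deriv_dilation (h : ℂ → ℂ) (ζ : ℂ) :
    Measurable fun p : ℂ × ℝ =>
      2 * (p.2 : ℂ) * (p.1 - ζ) * deriv h (ζ + (p.2 ^ 2 : ℝ) * (p.1 - ζ)) := by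
  have : Measurable (deriv h) := measurable_deriv h
  fun_prop

/-- Cauchy–Schwarz in t, the kernel growth under contraction, Tonelli, and the change of variables z
= ζ + t²(w - ζ). The constant does not depend on t₀ or on ζ. -/
theorem lintegral_segmentVariation_sq_le (h : ℂ → ℂ) {ζ : ℂ} (hζ : ‖ζ‖ < 1) {t₀ : ℝ}
    (ht₀ : 0 < t₀) (ht : (1 - ‖ζ‖) / 4 ≤ t₀ ^ 2) :
    ∫⁻ w in ball 0 1, segmentVariation h ζ t₀ w ^ 2 * diskKernel ζ w ≤
      400 * ∫⁻ w in ball 0 1, ‖deriv h w‖ₑ ^ 2 * diskKernel ζ w := by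
  set Φ : ℂ → ℝ≥0∞ :=
    (ball (0 : ℂ) 1).indicator fun w => ‖deriv h w‖ₑ ^ 2 * diskKernel ζ w with hΦ
  have hΦm : Measurable Φ :=
    (((measurable_deriv h).enorm.pow_const 2).mul (measurable_diskKernel_right ζ)).indicator
      measurableSet_ball
  rw [← lintegral_indicator (f := fun w => ‖deriv h w‖ₑ ^ 2 * diskKernel ζ w) measurableSet_ball,
    ← hΦ]
  have hvol : volume (Icc t₀ 1) ≤ 1 := by
    rw [Real.volume_Icc]
    exact ENNReal.ofReal_le_one.2 (by linarith)
  have key : ∀ w ∈ ball (0 : ℂ) 1, segmentVariation h ζ t₀ w ^ 2 * diskKernel ζ w ≤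
      ∫⁻ t in Icc t₀ 1, ENNReal.ofReal (400 * t ^ 4) * Φ (ζ + (t ^ 2 : ℝ) * (w - ζ)) := by
    intro w hw
    rw [mem_ball, dist_zero_right] at hw
    have hm : Measurable fun t : ℝ =>
        ‖2 * (t : ℂ) * (w - ζ) * deriv h (ζ + (t ^ 2 : ℝ) * (w - ζ))‖ₑ :=
      ((measurable_deriv_dilation h ζ).comp (measurable_const.prodMk measurable_id)).enorm
    have h1 := sq_lintegral_le (volume.restrict (Icc t₀ 1)) hm.aemeasurable
    rw [Measure.restrict_apply_univ] at h1
    have h2 : segmentVariation h ζ t₀ w ^ 2 ≤ ∫⁻ t in Icc t₀ 1,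
        ‖2 * (t : ℂ) * (w - ζ) * deriv h (ζ + (t ^ 2 : ℝ) * (w - ζ))‖ₑ ^ 2 :=
      h1.trans (mul_le_of_le_one_left' hvol)
    calc _ ≤ _ := mul_le_mul_left h2 _
      _ = ∫⁻ t in Icc t₀ 1, ‖2 * (t : ℂ) * (w - ζ) * deriv h (ζ + (t ^ 2 : ℝ) * (w - ζ))‖ₑ ^ 2 *
            diskKernel ζ w := (lintegral_mul_const _ (hm.pow_const 2)).symm
      _ ≤ _ := by
        refine setLIntegral_mono' measurableSet_Icc fun t ht' => ?_
        have ht0 : 0 < t := ht₀.trans_le ht'.1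
        have ht2 : (1 - ‖ζ‖) / 4 ≤ t ^ 2 := ht.trans (by gcongr; exact ht'.1)
        have ht1 : t ^ 2 ≤ 1 := pow_le_one₀ ht0.le ht'.2
        have hz : ζ + (t ^ 2 : ℝ) * (w - ζ) ∈ ball (0 : ℂ) 1 := by
          simpa using norm_dilation_lt_one hζ hw (sq_nonneg t) ht1
        have hfl := sq_mul_diskKernel_le_dilation hζ hw ht2 ht1
        rw [hΦ, indicator_of_mem hz, enorm_mul, enorm_mul, mul_pow, mul_pow]
        have e1 : ‖2 * (t : ℂ)‖ₑ ^ 2 = ENNReal.ofReal (4 * t ^ 2) := by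
          rw [← ofReal_norm, ← ENNReal.ofReal_pow (norm_nonneg _), norm_mul,
            Complex.norm_real, mul_pow]
          norm_num
        have e2 : ENNReal.ofReal (400 * t ^ 4) =
            ENNReal.ofReal (4 * t ^ 2) * ENNReal.ofReal (100 * t ^ 2) := by
          rw [← ENNReal.ofReal_mul (by positivity)]
          congr 1; ring
        rw [e1, e2]
        calc _ = ENNReal.ofReal (4 * t ^ 2) * ‖deriv h (ζ + (t ^ 2 : ℝ) * (w - ζ))‖ₑ ^ 2 *
              (‖w - ζ‖ₑ ^ 2 * diskKernel ζ w) := by ring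
          _ ≤ _ := mul_le_mul_right hfl _
          _ = _ := by ring
  calc _ ≤ ∫⁻ w in ball 0 1, ∫⁻ t in Icc t₀ 1,
          ENNReal.ofReal (400 * t ^ 4) * Φ (ζ + (t ^ 2 : ℝ) * (w - ζ)) :=
        setLIntegral_mono' measurableSet_ball key
    _ ≤ ∫⁻ w, ∫⁻ t in Icc t₀ 1,
          ENNReal.ofReal (400 * t ^ 4) * Φ (ζ + (t ^ 2 : ℝ) * (w - ζ)) :=
        setLIntegral_le_lintegral _ _
    _ = ∫⁻ t in Icc t₀ 1, ∫⁻ w,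
          ENNReal.ofReal (400 * t ^ 4) * Φ (ζ + (t ^ 2 : ℝ) * (w - ζ)) := by
        refine lintegral_lintegral_swap (Measurable.aemeasurable ?_)
        unfold Function.uncurry
        fun_prop
    _ = ∫⁻ t in Icc t₀ 1, 400 * ∫⁻ w, Φ w := by
        refine setLIntegral_congr_fun measurableSet_Icc fun t ht' => ?_
        have ht0 : 0 < t := ht₀.trans_le ht'.1
        rw [lintegral_const_mul' _ _ ENNReal.ofReal_ne_top,
          lintegral_comp_dilation Φ ζ (by positivity), ← mul_assoc,
          ← ENNReal.ofReal_mul (by positivity)]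
        congr 1
        -- The squared speed 4t² times the kernel factor 100t² exactly cancels the Jacobian t⁻⁴.
        rw [show 400 * t ^ 4 * ((t ^ 2) ^ 2)⁻¹ = 400 by field_simp]
        simp
    _ ≤ _ := by
        rw [setLIntegral_const]
        exact mul_le_of_le_one_right' hvol

/-! ### Control near the pole and choice of a base point -/

/-- Near ζ the kernel is at least of order 1/(1 - |ζ|), and a disc of radius (1 - |ζ|)/4 around x
has area of order (1 - |ζ|)². The mean value inequality on that disc leaves one power of 1 - |ζ|. -/
theorem enorm_sq_mul_le_lintegral_diskKernel {f : ℂ → ℂ} (hf : DifferentiableOn ℂ f (ball 0 1))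
    {ζ x : ℂ} (hζ : ‖ζ‖ < 1) (hx : x ∈ ball ζ ((1 - ‖ζ‖) / 2)) :
    ‖f x‖ₑ ^ 2 * ENNReal.ofReal (1 - ‖ζ‖) ≤
      192 * ∫⁻ w in ball 0 1, ‖f w‖ₑ ^ 2 * diskKernel ζ w := by
  set a := 1 - ‖ζ‖ with ha
  have ha0 : 0 < a := by linarith
  rw [mem_ball, dist_eq_norm] at hx
  have hsub : ball x (a / 4) ⊆ ball ζ (3 / 4 * a) := by
    intro w hw
    rw [mem_ball, dist_eq_norm] at hw ⊢
    linarith [norm_sub_le_norm_sub_add_norm_sub w x ζ]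
  have hsub' : ball ζ (3 / 4 * a) ⊆ ball (0 : ℂ) 1 := by
    intro w hw
    rw [mem_ball, dist_eq_norm] at hw
    rw [mem_ball, dist_zero_right]
    have h1 := norm_add_le ζ (w - ζ)
    rw [add_sub_cancel] at h1
    linarith
  have h1 := enorm_sq_mul_volume_ball_le (hf.mono (hsub.trans hsub'))
  have h2 : ∫⁻ w in ball x (a / 4), ‖f w‖ₑ ^ 2 ≤
      ENNReal.ofReal (36 * a) * ∫⁻ w in ball 0 1, ‖f w‖ₑ ^ 2 * diskKernel ζ w := by
    calc _ ≤ ∫⁻ w in ball x (a / 4),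
          ENNReal.ofReal (36 * a) * (‖f w‖ₑ ^ 2 * diskKernel ζ w) := by
          refine setLIntegral_mono' measurableSet_ball fun w hw => ?_
          calc ‖f w‖ₑ ^ 2 = ‖f w‖ₑ ^ 2 * 1 := (mul_one _).symm
            _ ≤ ‖f w‖ₑ ^ 2 * (ENNReal.ofReal (36 * a) * diskKernel ζ w) := by
              gcongr
              exact one_le_diskKernel_of_mem_ball hζ (hsub hw)
            _ = _ := by ring
      _ ≤ ∫⁻ w in ball 0 1, ENNReal.ofReal (36 * a) * (‖f w‖ₑ ^ 2 * diskKernel ζ w) :=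
          lintegral_mono_set (hsub.trans hsub')
      _ = _ := lintegral_const_mul' _ _ ENNReal.ofReal_ne_top
  have h3 : ENNReal.ofReal a * ENNReal.ofReal (3 * a / 16) ≤ volume (ball x (a / 4)) := by
    rw [Complex.volume_ball, ← ENNReal.ofReal_mul ha0.le, ← ENNReal.ofReal_pow (by positivity),
      ← ENNReal.ofReal_coe_nnreal, ← ENNReal.ofReal_mul (by positivity)]
    apply ENNReal.ofReal_le_ofReal
    have := Real.pi_gt_three
    simp only [NNReal.coe_real_pi]
    nlinarith [mul_pos ha0 ha0]
  have h4 : ENNReal.ofReal (36 * a) = ENNReal.ofReal (3 * a / 16) * 192 := by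
    rw [show (192 : ℝ≥0∞) = ENNReal.ofReal 192 by simp, ← ENNReal.ofReal_mul (by positivity)]
    congr 1; ring
  have h5 : ENNReal.ofReal (3 * a / 16) * (‖f x‖ₑ ^ 2 * ENNReal.ofReal a) ≤
      ENNReal.ofReal (3 * a / 16) *
        (192 * ∫⁻ w in ball 0 1, ‖f w‖ₑ ^ 2 * diskKernel ζ w) := by
    calc _ = ‖f x‖ₑ ^ 2 * (ENNReal.ofReal a * ENNReal.ofReal (3 * a / 16)) := by ring
      _ ≤ _ := by gcongr
      _ ≤ _ := h1.trans h2
      _ = _ := by rw [h4]; ring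
  exact (ENNReal.mul_le_mul_iff_right (by simpa using ha0) ENNReal.ofReal_ne_top).1 h5

theorem ENNReal.add_sq_le_two_mul (a b : ℝ≥0∞) : (a + b) ^ 2 ≤ 2 * (a ^ 2 + b ^ 2) := by
  rcases eq_or_ne a ⊤ with rfl | ha
  · simp
  rcases eq_or_ne b ⊤ with rfl | hb
  · simp
  lift a to NNReal using ha
  lift b to NNReal using hb
  have h : (a + b) ^ 2 ≤ 2 * (a ^ 2 + b ^ 2) := add_sq_le
  exact_mod_cast h

theorem ENNReal.add_four_sq_le (a b c d : ℝ≥0∞) :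
    (a + b + (c + d)) ^ 2 ≤ 4 * (a ^ 2 + b ^ 2 + (c ^ 2 + d ^ 2)) := by
  calc _ ≤ 2 * ((a + b) ^ 2 + (c + d) ^ 2) := ENNReal.add_sq_le_two_mul _ _
    _ ≤ 2 * (2 * (a ^ 2 + b ^ 2) + 2 * (c ^ 2 + d ^ 2)) := by
      gcongr <;> exact ENNReal.add_sq_le_two_mul _ _
    _ = _ := by ring

/-- The previous bound applied to h' gives |h'|² ≤ 192 I/(1 - |ζ|), where I is the integral on the
right. The disc has diameter 1 - |ζ|, so the mean value theorem even leaves a spare factor 1 - |ζ|.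
-/
theorem enorm_sub_sq_le_lintegral_deriv {h : ℂ → ℂ} (hh : DifferentiableOn ℂ h (ball 0 1))
    {ζ x y : ℂ} (hζ : ‖ζ‖ < 1) (hx : x ∈ ball ζ ((1 - ‖ζ‖) / 2))
    (hy : y ∈ ball ζ ((1 - ‖ζ‖) / 2)) :
    ‖h x - h y‖ₑ ^ 2 ≤ 192 * ∫⁻ w in ball 0 1, ‖deriv h w‖ₑ ^ 2 * diskKernel ζ w := by
  set I := ∫⁻ w in ball 0 1, ‖deriv h w‖ₑ ^ 2 * diskKernel ζ w with hI
  rcases eq_or_ne I ⊤ with htop | hfin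
  · rw [htop, ENNReal.mul_top (by norm_num)]
    exact le_top
  have ha : 0 < 1 - ‖ζ‖ := by linarith
  have hderiv : ∀ z ∈ ball ζ ((1 - ‖ζ‖) / 2),
      ‖deriv h z‖ ≤ Real.sqrt (192 * I.toReal / (1 - ‖ζ‖)) := by
    intro z hz
    apply Real.le_sqrt_of_sq_le
    rw [le_div_iff₀ ha]
    have h1 := enorm_sq_mul_le_lintegral_diskKernel (hh.deriv isOpen_ball) hζ hz
    rw [← hI] at h1
    have h2 := ENNReal.toReal_mono (ENNReal.mul_ne_top (by norm_num) hfin) h1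
    simpa [ENNReal.toReal_mul, ENNReal.toReal_ofReal ha.le] using h2
  have hsub : ball ζ ((1 - ‖ζ‖) / 2) ⊆ ball (0 : ℂ) 1 := by
    apply ball_subset_ball'
    rw [dist_zero_right]
    linarith
  have hmv := (convex_ball ζ ((1 - ‖ζ‖) / 2)).norm_image_sub_le_of_norm_deriv_le
    (fun z hz => hh.differentiableAt (isOpen_ball.mem_nhds (hsub hz))) hderiv hy hx
  have hxy : ‖x - y‖ ≤ 1 - ‖ζ‖ := by
    rw [mem_ball, dist_eq_norm] at hx hy
    have := norm_sub_le_norm_sub_add_norm_sub x ζ y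
    rw [norm_sub_rev ζ y] at this
    linarith
  have h3 : ‖h x - h y‖ ^ 2 ≤ 192 * I.toReal := by
    have hQ : 0 ≤ 192 * I.toReal / (1 - ‖ζ‖) := by positivity
    calc ‖h x - h y‖ ^ 2
        ≤ (Real.sqrt (192 * I.toReal / (1 - ‖ζ‖)) * (1 - ‖ζ‖)) ^ 2 := by
          refine pow_le_pow_left₀ (norm_nonneg _) (hmv.trans ?_) 2
          gcongr
      _ = 192 * I.toReal * (1 - ‖ζ‖) := by
          rw [mul_pow, Real.sq_sqrt hQ]
          field_simp
      _ ≤ 192 * I.toReal := by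
          have : 0 ≤ I.toReal := ENNReal.toReal_nonneg
          nlinarith [norm_nonneg ζ]
  rw [← ofReal_norm, ← ENNReal.ofReal_pow (norm_nonneg _)]
  refine (ENNReal.ofReal_le_ofReal h3).trans (le_of_eq ?_)
  rw [ENNReal.ofReal_mul (by norm_num), ENNReal.ofReal_toReal hfin]
  simp

theorem measurable_segmentVariation (h : ℂ → ℂ) (ζ : ℂ) (t₀ : ℝ) :
    Measurable (segmentVariation h ζ t₀) := by
  have := (measurable_deriv_dilation h ζ).enorm
  exact this.lintegral_prod_right'

/-- The kernel is bounded below on the disc of radius 1/2, so the integral bound controls the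
average of the squared variation there; some point does no worse than the average. The constant is 8
· 400. -/
theorem exists_segmentVariation_sq_le (h : ℂ → ℂ) {ζ : ℂ} (hζ : ‖ζ‖ < 1) {t₀ : ℝ}
    (ht₀ : 0 < t₀) (ht : (1 - ‖ζ‖) / 4 ≤ t₀ ^ 2) :
    ∃ w ∈ ball (0 : ℂ) (1 / 2), segmentVariation h ζ t₀ w ^ 2 ≤
      (volume (ball (0 : ℂ) (1 / 2)))⁻¹ *
        (3200 * ∫⁻ w in ball 0 1, ‖deriv h w‖ₑ ^ 2 * diskKernel ζ w) := by
  set I := ∫⁻ w in ball 0 1, ‖deriv h w‖ₑ ^ 2 * diskKernel ζ w with hI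
  have hv0 : volume (ball (0 : ℂ) (1 / 2)) ≠ 0 := (measure_ball_pos _ _ (by norm_num)).ne'
  have hvt : volume (ball (0 : ℂ) (1 / 2)) ≠ ⊤ := measure_ball_lt_top.ne
  rcases eq_or_ne I ⊤ with htop | hfin
  · refine ⟨0, by simp, ?_⟩
    rw [htop, ENNReal.mul_top (by norm_num), ENNReal.mul_top (by simpa using hvt)]
    exact le_top
  have hint : ∫⁻ w in ball 0 (1 / 2), segmentVariation h ζ t₀ w ^ 2 ≤ 3200 * I := by
    calc _ ≤ ∫⁻ w in ball 0 (1 / 2),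
          8 * (segmentVariation h ζ t₀ w ^ 2 * diskKernel ζ w) := by
          refine setLIntegral_mono' measurableSet_ball fun w hw => ?_
          calc _ = segmentVariation h ζ t₀ w ^ 2 * 1 := (mul_one _).symm
            _ ≤ segmentVariation h ζ t₀ w ^ 2 * (8 * diskKernel ζ w) := by
              gcongr
              exact one_le_diskKernel_of_mem_ball_zero hζ hw
            _ = _ := by ring
      _ ≤ ∫⁻ w in ball 0 1, 8 * (segmentVariation h ζ t₀ w ^ 2 * diskKernel ζ w) :=
          lintegral_mono_set (ball_subset_ball (by norm_num))
      _ = 8 * ∫⁻ w in ball 0 1, segmentVariation h ζ t₀ w ^ 2 * diskKernel ζ w :=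
          lintegral_const_mul' _ _ (by norm_num)
      _ ≤ 8 * (400 * I) := by
          gcongr
          exact lintegral_segmentVariation_sq_le h hζ ht₀ ht
      _ = _ := by rw [← mul_assoc]; norm_num
  obtain ⟨w, hw, hle⟩ := exists_le_setLAverage (f := fun w => segmentVariation h ζ t₀ w ^ 2)
    (μ := volume) hv0 hvt ((measurable_segmentVariation h ζ t₀).pow_const 2).aemeasurable
  refine ⟨w, hw, hle.trans ?_⟩
  rw [setLAverage_eq, ENNReal.div_eq_inv_mul]
  gcongr

/-! ### The Poincaré inequality for interior poles -/

/-- Weighted Poincaré inequality for the disk kernel, uniform in the pole. -/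
theorem exists_lintegral_sq_mul_diskKernel_le :
    ∃ C : ℝ≥0∞, C ≠ ⊤ ∧ ∀ h : ℂ → ℂ, DifferentiableOn ℂ h (ball 0 1) → ∀ M : ℝ≥0∞,
      (∀ w ∈ ball (0 : ℂ) (1 / 2), ‖h w‖ₑ ^ 2 ≤ M) → ∀ ζ : ℂ, ‖ζ‖ < 1 →
      ∫⁻ w in ball 0 1, ‖h w‖ₑ ^ 2 * diskKernel ζ w ≤
        C * (M + ∫⁻ w in ball 0 1, ‖deriv h w‖ₑ ^ 2 * diskKernel ζ w) := by
  set V := (volume (ball (0 : ℂ) (1 / 2)))⁻¹ with hV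
  have hVt : V ≠ ⊤ := by
    rw [hV, ENNReal.inv_ne_top]
    exact (measure_ball_pos _ _ (by norm_num)).ne'
  set P := ENNReal.ofReal (8 * Real.pi) with hP
  have hPt : P ≠ ⊤ := ENNReal.ofReal_ne_top
  refine ⟨1600 + 4 * (192 + V * 3200 + 1) * P, by finiteness, fun h hh M hM ζ hζ => ?_⟩
  set I := ∫⁻ w in ball 0 1, ‖deriv h w‖ₑ ^ 2 * diskKernel ζ w with hI
  have ha : 0 < 1 - ‖ζ‖ := by linarith
  -- The smallest parameter for which the kernel growth holds; since |w - ζ| < 2, it also brings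
  -- every endpoint within (1 - |ζ|)/2 of ζ.
  set t₀ := Real.sqrt ((1 - ‖ζ‖) / 4) with ht₀
  have hts : t₀ ^ 2 = (1 - ‖ζ‖) / 4 := Real.sq_sqrt (by positivity)
  have ht0 : 0 < t₀ := Real.sqrt_pos.2 (by positivity)
  have ht1 : t₀ ≤ 1 := by nlinarith [norm_nonneg ζ]
  have hζb : ζ ∈ ball (0 : ℂ) 1 := by simpa using hζ
  obtain ⟨w₀, hw₀, hG₀⟩ := exists_segmentVariation_sq_le h hζ ht0 hts.ge
  have hw₀b : w₀ ∈ ball (0 : ℂ) 1 := ball_subset_ball (by norm_num) hw₀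
  have hend : ∀ w ∈ ball (0 : ℂ) 1,
      ζ + (t₀ ^ 2 : ℝ) * (w - ζ) ∈ ball ζ ((1 - ‖ζ‖) / 2) := by
    intro w hw
    rw [mem_ball, dist_zero_right] at hw
    rw [mem_ball, dist_eq_norm, add_sub_cancel_left, norm_mul, Complex.norm_real,
      Real.norm_of_nonneg (by positivity), hts]
    have := norm_sub_le w ζ
    nlinarith
  have hpt : ∀ w ∈ ball (0 : ℂ) 1, ‖h w‖ₑ ^ 2 ≤
      4 * segmentVariation h ζ t₀ w ^ 2 + 4 * (192 * I + (V * (3200 * I) + M)) := by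
    intro w hw
    have e1 := enorm_sub_le_lintegral_dilation hh hζb hw ht0.le ht1
    have e2 := enorm_sub_le_lintegral_dilation hh hζb hw₀b ht0.le ht1
    have e3 := enorm_sub_sq_le_lintegral_deriv hh hζ (hend w hw) (hend w₀ hw₀b)
    have e4 := hM w₀ hw₀
    set z := ζ + (t₀ ^ 2 : ℝ) * (w - ζ)
    set z₀ := ζ + (t₀ ^ 2 : ℝ) * (w₀ - ζ)
    -- The chain w → z → z₀ → w₀: contract, cross the disc around the pole, then climb back to the
    -- base point.
    have htri : ‖h w‖ₑ ≤ ‖h w - h z‖ₑ + ‖h z - h z₀‖ₑ + (‖h w₀ - h z₀‖ₑ + ‖h w₀‖ₑ) := by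
      have hdec : h w = (h w - h z) + (h z - h z₀) + (-(h w₀ - h z₀) + h w₀) := by ring
      calc ‖h w‖ₑ = ‖(h w - h z) + (h z - h z₀) + (-(h w₀ - h z₀) + h w₀)‖ₑ := by rw [← hdec]
        _ ≤ _ := (enorm_add_le _ _).trans
          (add_le_add (enorm_add_le _ _) ((enorm_add_le _ _).trans (by rw [enorm_neg])))
    calc ‖h w‖ₑ ^ 2 ≤ _ := pow_le_pow_left' htri 2
      _ ≤ _ := ENNReal.add_four_sq_le _ _ _ _
      _ ≤ 4 * (segmentVariation h ζ t₀ w ^ 2 + 192 * I + (V * (3200 * I) + M)) := by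
        gcongr
        · exact e1
        · exact (pow_le_pow_left' e2 2).trans hG₀
      _ = _ := by ring
  calc _ ≤ ∫⁻ w in ball 0 1, (4 * (segmentVariation h ζ t₀ w ^ 2 * diskKernel ζ w) +
        4 * (192 * I + (V * (3200 * I) + M)) * diskKernel ζ w) := by
        refine setLIntegral_mono' measurableSet_ball fun w hw => ?_
        calc _ ≤ _ := mul_le_mul_left (hpt w hw) _
          _ = _ := by ring
    _ = 4 * (∫⁻ w in ball 0 1, segmentVariation h ζ t₀ w ^ 2 * diskKernel ζ w) +
        4 * (192 * I + (V * (3200 * I) + M)) * ∫⁻ w in ball 0 1, diskKernel ζ w := by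
        rw [lintegral_add_right _ ((measurable_diskKernel_right ζ).const_mul _),
          lintegral_const_mul' _ _ (by norm_num),
          lintegral_const_mul _ (measurable_diskKernel_right ζ)]
    _ ≤ 4 * (400 * I) + 4 * (192 * I + (V * (3200 * I) + M)) * P := by
        gcongr
        · exact lintegral_segmentVariation_sq_le h hζ ht0 hts.ge
        · exact lintegral_diskKernel_le hζ.le
    _ ≤ 4 * (400 * (M + I)) + 4 * (192 * (M + I) + (V * (3200 * (M + I)) + (M + I))) * P := by
        gcongr <;> simp
    _ = _ := by ring

/-! ### Poles on the unit circle -/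

/-- For u = conj ζ w in the closed disc, 1 - r ≤ |1 - ru|, hence |1 - u| ≤ 2|1 - ru|. This keeps the
derivative integrals for the poles rζ under control uniformly in r. -/
theorem diskKernel_smul_le {ζ w : ℂ} (hζ : ‖ζ‖ ≤ 1) (hw : ‖w‖ < 1) {r : ℝ} (h0 : 0 ≤ r)
    (h1 : r ≤ 1) : diskKernel (r * ζ) w ≤ 4 * diskKernel ζ w := by
  have hA := norm_one_sub_conj_mul_pos hζ hw
  set u := conj ζ * w with hu
  have hu1 : ‖u‖ ≤ 1 := by
    rw [hu, norm_mul, RCLike.norm_conj]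
    nlinarith [norm_nonneg ζ, norm_nonneg w]
  have e0 : conj (r * ζ) * w = r * u := by rw [map_mul, Complex.conj_ofReal, hu, mul_assoc]
  have e1 : ‖1 - u‖ ≤ ‖1 - r * u‖ + (1 - r) := by
    have : 1 - u = (1 - r * u) - ((1 - r : ℝ) : ℂ) * u := by push_cast; ring
    have h2 := norm_sub_le (1 - r * u) (((1 - r : ℝ) : ℂ) * u)
    rw [← this, norm_mul, Complex.norm_real, Real.norm_of_nonneg (by linarith)] at h2
    nlinarith [norm_nonneg u]
  have e2 : 1 - r ≤ ‖1 - r * u‖ := by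
    have h2 := norm_sub_norm_le (1 : ℂ) (r * u)
    rw [norm_one, norm_mul, Complex.norm_real, Real.norm_of_nonneg h0] at h2
    nlinarith [norm_nonneg u]
  have e3 : ‖1 - u‖ / 2 ≤ ‖1 - r * u‖ := by linarith
  have hD : 0 ≤ 1 - ‖w‖ ^ 2 := by nlinarith [norm_nonneg w]
  unfold diskKernel
  rw [e0, ← hu, show (4 : ℝ≥0∞) = ENNReal.ofReal 4 by simp, ← ENNReal.ofReal_mul (by norm_num)]
  apply ENNReal.ofReal_le_ofReal
  calc _ ≤ (1 - ‖w‖ ^ 2) / (‖1 - u‖ / 2) ^ 2 := by gcongr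
    _ = _ := by field_simp; norm_num

theorem tendsto_diskKernel_smul {ζ w : ℂ} (hζ : ‖ζ‖ ≤ 1) (hw : ‖w‖ < 1) {r : ℕ → ℝ}
    (hr : Filter.Tendsto r Filter.atTop (nhds 1)) :
    Filter.Tendsto (fun n => diskKernel (r n * ζ) w) Filter.atTop (nhds (diskKernel ζ w)) := by
  have hA := norm_one_sub_conj_mul_pos hζ hw
  have hc : ContinuousAt (fun x : ℝ => diskKernel (x * ζ) w) 1 := by
    unfold diskKernel
    refine ENNReal.continuous_ofReal.continuousAt.comp ?_
    refine ContinuousAt.div (by fun_prop) ?_ ?_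
    · have : Continuous fun x : ℝ => conj ((x : ℂ) * ζ) :=
        Complex.continuous_conj.comp (by fun_prop)
      fun_prop
    · simpa using hA.ne'
  simpa [Function.comp_def] using hc.tendsto.comp hr

theorem poissonWeight_eq_diskKernel {ζ : ℂ} (hζ : ‖ζ‖ = 1) (w : ℂ) :
    poissonWeight ζ w = diskKernel ζ w := by
  have : ‖1 - conj ζ * w‖ = ‖ζ - w‖ := by
    have h1 : conj ζ * (ζ - w) = 1 - conj ζ * w := by
      rw [mul_sub, Complex.conj_mul', hζ]
      simp
    rw [← h1, norm_mul, RCLike.norm_conj, hζ, one_mul]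
  rw [poissonWeight, diskKernel, this]

/-- Apply the interior inequality at the poles r_n ζ with r_n → 1; Fatou passes to the limit on the
left, the uniform domination handles the right. -/
theorem exists_lintegral_sq_mul_poissonWeight_le :
    ∃ C : ℝ≥0∞, C ≠ ⊤ ∧ ∀ h : ℂ → ℂ, DifferentiableOn ℂ h (ball 0 1) → ∀ M : ℝ≥0∞,
      (∀ w ∈ ball (0 : ℂ) (1 / 2), ‖h w‖ₑ ^ 2 ≤ M) → ∀ ζ : ℂ, ‖ζ‖ = 1 →
      ∫⁻ w in ball 0 1, ‖h w‖ₑ ^ 2 * poissonWeight ζ w ≤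
        C * (M + ∫⁻ w in ball 0 1, ‖deriv h w‖ₑ ^ 2 * poissonWeight ζ w) := by
  obtain ⟨C, hC, hmain⟩ := exists_lintegral_sq_mul_diskKernel_le
  refine ⟨C * 4, by finiteness, fun h hh M hM ζ hζ => ?_⟩
  simp_rw [poissonWeight_eq_diskKernel hζ]
  set r : ℕ → ℝ := fun n => 1 - 1 / ((n : ℝ) + 1) with hr
  have hr0 : ∀ n, 0 ≤ r n := fun n => by
    have : 1 / ((n : ℝ) + 1) ≤ 1 := (div_le_one (by positivity)).2 (by simp)
    simp only [hr]; linarith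
  have hr1 : ∀ n, r n < 1 := fun n => by
    have : 0 < 1 / ((n : ℝ) + 1) := by positivity
    simp only [hr]; linarith
  have hrt : Filter.Tendsto r Filter.atTop (nhds 1) := by
    simpa [hr] using tendsto_one_div_add_atTop_nhds_zero_nat.const_sub (1 : ℝ)
  have hbound : ∀ n, ∫⁻ w in ball 0 1, ‖h w‖ₑ ^ 2 * diskKernel (r n * ζ) w ≤
      C * 4 * (M + ∫⁻ w in ball 0 1, ‖deriv h w‖ₑ ^ 2 * diskKernel ζ w) := by
    intro n
    have hn : ‖(r n : ℂ) * ζ‖ < 1 := by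
      rw [norm_mul, hζ, mul_one, Complex.norm_real, Real.norm_of_nonneg (hr0 n)]
      exact hr1 n
    refine (hmain h hh M hM _ hn).trans ?_
    have : ∫⁻ w in ball 0 1, ‖deriv h w‖ₑ ^ 2 * diskKernel (r n * ζ) w ≤
        4 * ∫⁻ w in ball 0 1, ‖deriv h w‖ₑ ^ 2 * diskKernel ζ w := by
      rw [← lintegral_const_mul' _ _ (by norm_num)]
      refine setLIntegral_mono' measurableSet_ball fun w hw => ?_
      rw [mul_left_comm]
      gcongr
      exact diskKernel_smul_le hζ.le (by simpa using hw) (hr0 n) (hr1 n).le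
    calc _ ≤ C * (4 * M + 4 * ∫⁻ w in ball 0 1, ‖deriv h w‖ₑ ^ 2 * diskKernel ζ w) := by
          gcongr
          exact le_mul_of_one_le_left' (by norm_num)
      _ = _ := by ring
  have hhm : AEMeasurable (fun w => ‖h w‖ₑ ^ 2) (volume.restrict (ball (0 : ℂ) 1)) :=
    (hh.continuousOn.aemeasurable measurableSet_ball).enorm.pow_const 2
  calc ∫⁻ w in ball 0 1, ‖h w‖ₑ ^ 2 * diskKernel ζ w
      ≤ ∫⁻ w in ball 0 1, Filter.liminf
          (fun n => ‖h w‖ₑ ^ 2 * diskKernel (r n * ζ) w) Filter.atTop := by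
        refine setLIntegral_mono' measurableSet_ball fun w hw => ?_
        refine le_of_eq (Filter.Tendsto.liminf_eq ?_).symm
        exact ENNReal.Tendsto.const_mul
          (tendsto_diskKernel_smul hζ.le (by simpa using hw) hrt) (Or.inr (by finiteness))
    _ ≤ Filter.liminf (fun n => ∫⁻ w in ball 0 1, ‖h w‖ₑ ^ 2 * diskKernel (r n * ζ) w)
          Filter.atTop :=
        lintegral_liminf_le' fun n => hhm.mul (measurable_diskKernel_right _).aemeasurable
    _ ≤ _ := Filter.liminf_le_of_frequently_le' (Filter.Frequently.of_forall hbound)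

/-! ### The Green kernel -/

/-- With x = |1 - conj ζ w|²/|w - ζ|², the inequality 1 - 1/x ≤ log x gives exactly the disk kernel
after division by 1 - |ζ|². -/
theorem diskKernel_le_greenKernel {ζ w : ℂ} (hζ : ‖ζ‖ < 1) (hw : ‖w‖ < 1) :
    diskKernel ζ w ≤ greenKernel ζ w := by
  unfold diskKernel greenKernel
  split_ifs with hne
  · exact le_top
  have hv : 0 < ‖w - ζ‖ := norm_pos_iff.2 (sub_ne_zero.2 hne)
  have hA := norm_one_sub_conj_mul_pos hζ.le hw
  have hδ : 0 < 1 - ‖ζ‖ ^ 2 := by nlinarith [norm_nonneg ζ]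
  apply ENNReal.ofReal_le_ofReal
  rw [norm_div, le_div_iff₀ hδ]
  have hlog := Real.one_sub_inv_le_log_of_pos
    (show 0 < (‖1 - conj ζ * w‖ / ‖w - ζ‖) ^ 2 by positivity)
  refine le_trans (le_of_eq ?_) hlog
  have hid := norm_one_sub_conj_mul_sq ζ w
  field_simp
  linarith

/-- Here log x ≤ x - 1 produces the disk kernel with |w - ζ|² as denominator. Off the excluded ball
|1 - conj ζ w| ≤ 5|w - ζ|, whence 25. -/
theorem greenKernel_le_diskKernel {ζ w : ℂ} (hζ : ‖ζ‖ < 1) (hw : ‖w‖ < 1)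
    (hfar : w ∉ ball ζ ((1 - ‖ζ‖) / 2)) : greenKernel ζ w ≤ 25 * diskKernel ζ w := by
  rw [mem_ball, dist_eq_norm, not_lt] at hfar
  have hv : 0 < ‖w - ζ‖ := by linarith
  have hne : w ≠ ζ := sub_ne_zero.1 (norm_pos_iff.1 hv)
  have hA := norm_one_sub_conj_mul_pos hζ.le hw
  have hA5 := norm_one_sub_conj_mul_le (w := w) hζ.le
  have hδ : 0 < 1 - ‖ζ‖ ^ 2 := by nlinarith [norm_nonneg ζ]
  have hD : 0 < 1 - ‖w‖ ^ 2 := by nlinarith [norm_nonneg w]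
  rw [greenKernel, if_neg hne, diskKernel, show (25 : ℝ≥0∞) = ENNReal.ofReal 25 by simp,
    ← ENNReal.ofReal_mul (by norm_num)]
  apply ENNReal.ofReal_le_ofReal
  rw [norm_div]
  have hlog := Real.log_le_sub_one_of_pos
    (show 0 < (‖1 - conj ζ * w‖ / ‖w - ζ‖) ^ 2 by positivity)
  have hid := norm_one_sub_conj_mul_sq ζ w
  calc _ ≤ ((‖1 - conj ζ * w‖ / ‖w - ζ‖) ^ 2 - 1) / (1 - ‖ζ‖ ^ 2) := by gcongr
    _ = 25 * ((1 - ‖w‖ ^ 2) / (5 * ‖w - ζ‖) ^ 2) := by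
        rw [div_pow, hid]
        field_simp
        norm_num
    _ ≤ _ := by
        gcongr
        linarith

theorem greenKernel_le_inv_norm {ζ w : ℂ} (hζ : ‖ζ‖ < 1) (hne : w ≠ ζ)
    (hnear : w ∈ ball ζ ((1 - ‖ζ‖) / 2)) :
    greenKernel ζ w ≤ 6 * ENNReal.ofReal (‖w - ζ‖⁻¹) := by
  rw [mem_ball, dist_eq_norm] at hnear
  have hw : ‖w‖ < 1 := by
    have h1 := norm_add_le ζ (w - ζ)
    rw [add_sub_cancel] at h1
    linarith
  have hv : 0 < ‖w - ζ‖ := norm_pos_iff.2 (sub_ne_zero.2 hne)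
  have hA := norm_one_sub_conj_mul_pos hζ.le hw
  have hA3 := norm_one_sub_conj_mul_le (w := w) hζ.le
  have hδ : 1 - ‖ζ‖ ≤ 1 - ‖ζ‖ ^ 2 := by nlinarith [norm_nonneg ζ]
  have ha : 0 < 1 - ‖ζ‖ := by linarith
  rw [greenKernel, if_neg hne, show (6 : ℝ≥0∞) = ENNReal.ofReal 6 by simp,
    ← ENNReal.ofReal_mul (by norm_num)]
  apply ENNReal.ofReal_le_ofReal
  rw [norm_div, Real.log_pow, div_le_iff₀ (by linarith)]
  have hlog := Real.log_le_sub_one_of_pos (show 0 < ‖1 - conj ζ * w‖ / ‖w - ζ‖ by positivity)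
  push_cast
  calc 2 * Real.log (‖1 - conj ζ * w‖ / ‖w - ζ‖) ≤ 2 * (‖1 - conj ζ * w‖ / ‖w - ζ‖) := by linarith
    _ ≤ 2 * ((3 * (1 - ‖ζ‖ ^ 2)) / ‖w - ζ‖) := by
        gcongr
        linarith
    _ = _ := by ring

/-- Only the function side needs the upper bounds on the Green kernel. Near the pole, the mean value
inequality gives |h|² ≤ 192 J/(1 - |ζ|) with J the disk-kernel integral of |h|², and the integral of
1/|w - ζ| there is at most π(1 - |ζ|), so the singular part is also bounded by a multiple of J. -/
theorem exists_lintegral_sq_mul_greenKernel_le :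
    ∃ C : ℝ≥0∞, C ≠ ⊤ ∧ ∀ h : ℂ → ℂ, DifferentiableOn ℂ h (ball 0 1) → ∀ M : ℝ≥0∞,
      (∀ w ∈ ball (0 : ℂ) (1 / 2), ‖h w‖ₑ ^ 2 ≤ M) → ∀ ζ : ℂ, ‖ζ‖ < 1 →
      ∫⁻ w in ball 0 1, ‖h w‖ₑ ^ 2 * greenKernel ζ w ≤
        C * (M + ∫⁻ w in ball 0 1, ‖deriv h w‖ₑ ^ 2 * greenKernel ζ w) := by
  obtain ⟨C, hC, hmain⟩ := exists_lintegral_sq_mul_diskKernel_le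
  refine ⟨(25 + 192 * 6 * ENNReal.ofReal Real.pi) * C, by finiteness, fun h hh M hM ζ hζ => ?_⟩
  set J := ∫⁻ w in ball 0 1, ‖h w‖ₑ ^ 2 * diskKernel ζ w with hJ
  set B := ball ζ ((1 - ‖ζ‖) / 2) with hB
  have ha : 0 < 1 - ‖ζ‖ := by linarith
  have ha0 : ENNReal.ofReal (1 - ‖ζ‖) ≠ 0 := by simpa using ha
  have hnear : ∫⁻ w in B, ‖h w‖ₑ ^ 2 * greenKernel ζ w ≤
      192 * 6 * ENNReal.ofReal Real.pi * J := by
    calc _ ≤ ∫⁻ w in B, 192 * J / ENNReal.ofReal (1 - ‖ζ‖) * 6 *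
          ENNReal.ofReal (‖w - ζ‖⁻¹) := by
          refine lintegral_mono_ae ?_
          have h1 : ∀ᵐ w ∂(volume.restrict B), w ≠ ζ := ae_restrict_of_ae (Measure.ae_ne volume ζ)
          filter_upwards [h1, ae_restrict_mem measurableSet_ball] with w h1 h2
          rw [mul_assoc]
          refine mul_le_mul' ?_ (greenKernel_le_inv_norm hζ h1 h2)
          rw [ENNReal.le_div_iff_mul_le (Or.inl ha0) (Or.inl ENNReal.ofReal_ne_top)]
          exact enorm_sq_mul_le_lintegral_diskKernel hh hζ h2
      _ ≤ 192 * J / ENNReal.ofReal (1 - ‖ζ‖) * 6 *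
          (ENNReal.ofReal (1 - ‖ζ‖) * ENNReal.ofReal Real.pi) := by
          rw [lintegral_const_mul _ (by fun_prop)]
          gcongr
          refine (lintegral_ball_inv_norm_le ζ _ (by positivity)).trans (le_of_eq ?_)
          rw [← ENNReal.ofReal_mul ha.le]
          congr 1; ring
      _ = 192 * J / ENNReal.ofReal (1 - ‖ζ‖) * ENNReal.ofReal (1 - ‖ζ‖) *
          (6 * ENNReal.ofReal Real.pi) := by ring
      _ = _ := by
          rw [ENNReal.div_mul_cancel ha0 ENNReal.ofReal_ne_top]
          ring
  have hfar : ∫⁻ w in ball 0 1 \ B, ‖h w‖ₑ ^ 2 * greenKernel ζ w ≤ 25 * J := by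
    rw [hJ, ← lintegral_const_mul' _ _ (by norm_num)]
    refine (setLIntegral_mono' (measurableSet_ball.diff measurableSet_ball) fun w hw => ?_).trans
      (lintegral_mono_set sdiff_subset)
    rw [mul_left_comm]
    gcongr
    exact greenKernel_le_diskKernel hζ (by simpa using hw.1) hw.2
  calc _ ≤ ∫⁻ w in (ball 0 1 \ B) ∪ B, ‖h w‖ₑ ^ 2 * greenKernel ζ w :=
        lintegral_mono_set (by rw [sdiff_union_self]; exact subset_union_left)
    _ ≤ 25 * J + 192 * 6 * ENNReal.ofReal Real.pi * J :=
        (lintegral_union_le _ _ _).trans (add_le_add hfar hnear)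
    _ = (25 + 192 * 6 * ENNReal.ofReal Real.pi) * J := by ring
    _ ≤ (25 + 192 * 6 * ENNReal.ofReal Real.pi) *
        (C * (M + ∫⁻ w in ball 0 1, ‖deriv h w‖ₑ ^ 2 * diskKernel ζ w)) := by
        gcongr
        exact hmain h hh M hM ζ hζ
    _ ≤ (25 + 192 * 6 * ENNReal.ofReal Real.pi) *
        (C * (M + ∫⁻ w in ball 0 1, ‖deriv h w‖ₑ ^ 2 * greenKernel ζ w)) := by
        gcongr 2
        refine add_le_add le_rfl (setLIntegral_mono' measurableSet_ball fun w hw => ?_)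
        gcongr
        exact diskKernel_le_greenKernel hζ (by simpa using hw)
    _ = _ := by ring

/-! ### Superposition of the kernels -/

theorem measurable_greenKernel : Measurable (Function.uncurry greenKernel) := by
  unfold greenKernel Function.uncurry
  refine Measurable.ite (measurableSet_eq_fun measurable_snd measurable_fst) measurable_const ?_
  fun_prop

theorem measurable_poissonWeight : Measurable (Function.uncurry poissonWeight) := by
  unfold poissonWeight Function.uncurry
  fun_prop

theorem measurable_uncurry_coe {X : Set ℂ} {K : ℂ → ℂ → ℝ≥0∞}
    (hK : Measurable (Function.uncurry K)) :
    Measurable (Function.uncurry fun (ζ : X) w => K ζ w) :=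
  hK.comp ((measurable_subtype_coe.comp measurable_fst).prodMk measurable_snd)

theorem lintegral_sq_mul_lintegral_le {α : Type*} [MeasurableSpace α] (ν : Measure α) [SFinite ν]
    {K : α → ℂ → ℝ≥0∞} (hK : Measurable (Function.uncurry K)) {h : ℂ → ℂ}
    (hh : DifferentiableOn ℂ h (ball 0 1)) {C M : ℝ≥0∞} (hC : C ≠ ⊤)
    (hle : ∀ᵐ x ∂ν, ∫⁻ w in ball 0 1, ‖h w‖ₑ ^ 2 * K x w ≤
      C * (M + ∫⁻ w in ball 0 1, ‖deriv h w‖ₑ ^ 2 * K x w)) :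
    ∫⁻ w in ball 0 1, ‖h w‖ₑ ^ 2 * ∫⁻ x, K x w ∂ν ≤
      C * (M * ν univ + ∫⁻ w in ball 0 1, ‖deriv h w‖ₑ ^ 2 * ∫⁻ x, K x w ∂ν) := by
  have hswap : ∀ f : ℂ → ℂ, AEMeasurable f (volume.restrict (ball (0 : ℂ) 1)) →
      ∫⁻ w in ball 0 1, ‖f w‖ₑ ^ 2 * ∫⁻ x, K x w ∂ν =
        ∫⁻ x, (∫⁻ w in ball 0 1, ‖f w‖ₑ ^ 2 * K x w) ∂ν := by
    intro f hf
    have hKw : ∀ w, Measurable fun x => K x w := fun w =>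
      hK.comp (measurable_id.prodMk measurable_const)
    rw [← lintegral_lintegral_swap]
    · exact lintegral_congr fun w => (lintegral_const_mul _ (hKw w)).symm
    · exact (hf.comp_fst.enorm.pow_const 2).mul (hK.comp measurable_swap).aemeasurable
  rw [hswap h (hh.continuousOn.aemeasurable measurableSet_ball),
    hswap _ (measurable_deriv h).aemeasurable]
  refine (lintegral_mono_ae hle).trans (le_of_eq ?_)
  rw [lintegral_const_mul' _ _ hC, lintegral_add_left measurable_const, lintegral_const]

/-- The per-pole inequalities have constants independent of the pole, so they integrate against μ;
finiteness of μ keeps the term with M finite. -/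
theorem lintegral_sq_mul_superharmonicWeight_lt_top (μ : Measure (closedBall (0 : ℂ) 1))
    [IsFiniteMeasure μ] {h : ℂ → ℂ} (hh : DifferentiableOn ℂ h (ball 0 1))
    (hfin : ∫⁻ w in ball 0 1, ‖deriv h w‖ₑ ^ 2 * superharmonicWeight μ w < ⊤) :
    ∫⁻ w in ball 0 1, ‖h w‖ₑ ^ 2 * superharmonicWeight μ w < ⊤ := by
  obtain ⟨C₁, hC₁, h₁⟩ := exists_lintegral_sq_mul_greenKernel_le
  obtain ⟨C₂, hC₂, h₂⟩ := exists_lintegral_sq_mul_poissonWeight_le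
  obtain ⟨M, hM⟩ := (isCompact_closedBall (0 : ℂ) (1 / 2)).exists_bound_of_continuousOn
    (hh.continuousOn.mono (closedBall_subset_ball (by norm_num)))
  have hM' : ∀ w ∈ ball (0 : ℂ) (1 / 2), ‖h w‖ₑ ^ 2 ≤ ENNReal.ofReal M ^ 2 := by
    intro w hw
    rw [← ofReal_norm]
    gcongr
    exact hM w (ball_subset_closedBall hw)
  have hmg := measurable_uncurry_coe (X := closedBall (0 : ℂ) 1) measurable_greenKernel
  have hmp := measurable_uncurry_coe (X := closedBall (0 : ℂ) 1) measurable_poissonWeight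
  have hnorm : Measurable fun ζ : closedBall (0 : ℂ) 1 => ‖(ζ : ℂ)‖ :=
    measurable_subtype_coe.norm
  set S : Set (closedBall (0 : ℂ) 1) := {ζ | ‖(ζ : ℂ)‖ < 1} with hS
  set T : Set (closedBall (0 : ℂ) 1) := {ζ | ‖(ζ : ℂ)‖ = 1} with hT
  have hSm : MeasurableSet S := measurableSet_lt hnorm measurable_const
  have hTm : MeasurableSet T := measurableSet_eq_fun hnorm measurable_const
  have e₁ := lintegral_sq_mul_lintegral_le (μ.restrict S) hmg hh hC₁
    (ae_restrict_of_forall_mem hSm fun ζ hζ => h₁ h hh _ hM' ζ hζ)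
  have e₂ := lintegral_sq_mul_lintegral_le (μ.restrict T) hmp hh hC₂
    (ae_restrict_of_forall_mem hTm fun ζ hζ => h₂ h hh _ hM' ζ hζ)
  have hU : ∀ w, superharmonicWeight μ w =
      (∫⁻ ζ in S, greenKernel ζ w ∂μ) + ∫⁻ ζ in T, poissonWeight ζ w ∂μ := fun w => rfl
  have hSmeas : Measurable fun w => ∫⁻ ζ in S, greenKernel ζ w ∂μ :=
    Measurable.lintegral_prod_left' hmg
  have hsplit : ∀ f : ℂ → ℂ, AEMeasurable f (volume.restrict (ball (0 : ℂ) 1)) →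
      ∫⁻ w in ball 0 1, ‖f w‖ₑ ^ 2 * superharmonicWeight μ w =
      (∫⁻ w in ball 0 1, ‖f w‖ₑ ^ 2 * ∫⁻ ζ in S, greenKernel ζ w ∂μ) +
        ∫⁻ w in ball 0 1, ‖f w‖ₑ ^ 2 * ∫⁻ ζ in T, poissonWeight ζ w ∂μ := by
    intro f hf
    simp_rw [hU, mul_add]
    exact lintegral_add_left' ((hf.enorm.pow_const 2).mul hSmeas.aemeasurable) _
  rw [hsplit _ (measurable_deriv h).aemeasurable, ENNReal.add_lt_top] at hfin
  rw [hsplit _ (hh.continuousOn.aemeasurable measurableSet_ball), ENNReal.add_lt_top]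
  constructor
  · refine e₁.trans_lt ?_
    have := hfin.1
    finiteness
  · refine e₂.trans_lt ?_
    have := hfin.2
    finiteness

/-! ### Difference quotients and the Gleason property -/

/-- On a small closed disc around a, g = `dslope h a` and g' are bounded by compactness. Outside it
|z - a| is bounded below, so one divides in h - h(a) = (z - a)g and in h' - g = (z - a)g'. -/
theorem exists_norm_dslope_le {h : ℂ → ℂ} (hh : DifferentiableOn ℂ h (ball 0 1)) {a : ℂ}
    (ha : a ∈ ball (0 : ℂ) 1) :
    ∃ K : NNReal, ∀ z ∈ ball (0 : ℂ) 1, ‖dslope h a z‖ₑ ≤ K * (‖h z‖ₑ + 1) ∧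
      ‖deriv (dslope h a) z‖ₑ ≤ K * (‖deriv h z‖ₑ + ‖h z‖ₑ + 1) := by
  have hg : DifferentiableOn ℂ (dslope h a) (ball 0 1) :=
    (Complex.differentiableOn_dslope (isOpen_ball.mem_nhds ha)).2 hh
  have hrel : ∀ z, h z - h a = (z - a) * dslope h a z := fun z => by
    simpa using (sub_smul_dslope h a z).symm
  rw [mem_ball, dist_zero_right] at ha
  set ρ := (1 - ‖a‖) / 2 with hρ
  have hρ0 : 0 < ρ := by simp only [hρ]; linarith
  have hsub : closedBall a ρ ⊆ ball (0 : ℂ) 1 := by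
    intro z hz
    rw [mem_closedBall, dist_eq_norm] at hz
    rw [mem_ball, dist_zero_right]
    have h1 := norm_add_le a (z - a)
    rw [add_sub_cancel] at h1
    linarith
  obtain ⟨K₁, hK₁⟩ := (isCompact_closedBall a ρ).exists_bound_of_continuousOn
    (hg.continuousOn.mono hsub)
  obtain ⟨K₂, hK₂⟩ := (isCompact_closedBall a ρ).exists_bound_of_continuousOn
    ((hg.deriv isOpen_ball).continuousOn.mono hsub)
  have hK₁0 : 0 ≤ K₁ := (norm_nonneg _).trans (hK₁ a (mem_closedBall_self hρ0.le))
  have hK₂0 : 0 ≤ K₂ := (norm_nonneg _).trans (hK₂ a (mem_closedBall_self hρ0.le))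
  set A := K₁ + (1 + ‖h a‖) / ρ with hA
  have hA0 : 0 ≤ A := by positivity
  have hbg : ∀ z ∈ ball (0 : ℂ) 1, ‖dslope h a z‖ ≤ A * (‖h z‖ + 1) := by
    intro z hz
    by_cases hza : z ∈ closedBall a ρ
    · have h1 := hK₁ z hza
      have h2 : K₁ ≤ A := by simp only [hA]; linarith [show 0 ≤ (1 + ‖h a‖) / ρ by positivity]
      nlinarith [norm_nonneg (h z)]
    · rw [mem_closedBall, dist_eq_norm, not_le] at hza
      have h1 := congrArg norm (hrel z)
      rw [norm_mul] at h1
      have h2 := norm_sub_le (h z) (h a)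
      have h3 : ‖dslope h a z‖ * ρ ≤ ‖h z‖ + ‖h a‖ := by
        nlinarith [norm_nonneg (dslope h a z)]
      have h4 : ‖dslope h a z‖ ≤ (‖h z‖ + ‖h a‖) / ρ := (le_div_iff₀ hρ0).2 h3
      have h5 : (‖h z‖ + ‖h a‖) / ρ ≤ (1 + ‖h a‖) / ρ * (‖h z‖ + 1) := by
        rw [div_mul_eq_mul_div]
        gcongr
        nlinarith [norm_nonneg (h z), norm_nonneg (h a), mul_nonneg (norm_nonneg (h z))
          (norm_nonneg (h a))]
      have h6 : 0 ≤ K₁ * (‖h z‖ + 1) := by positivity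
      simp only [hA]
      linarith
  set A' := K₂ + (1 + A) / ρ with hA'
  have hA'0 : 0 ≤ A' := by positivity
  have hbg' : ∀ z ∈ ball (0 : ℂ) 1,
      ‖deriv (dslope h a) z‖ ≤ A' * (‖deriv h z‖ + ‖h z‖ + 1) := by
    intro z hz
    by_cases hza : z ∈ closedBall a ρ
    · have h1 := hK₂ z hza
      have h2 : K₂ ≤ A' := by simp only [hA']; linarith [show 0 ≤ (1 + A) / ρ by positivity]
      nlinarith [norm_nonneg (h z), norm_nonneg (deriv h z)]
    · rw [mem_closedBall, dist_eq_norm, not_le] at hza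
      have hd : deriv h z = dslope h a z + (z - a) * deriv (dslope h a) z := by
        have h1 := (hg.differentiableAt (isOpen_ball.mem_nhds hz)).hasDerivAt
        have h2 := (((hasDerivAt_id z).sub_const a).mul h1).const_add (h a)
        have h4 : HasDerivAt h (1 * dslope h a z + (id z - a) * deriv (dslope h a) z) z := by
          refine h2.congr_of_eventuallyEq (.of_forall fun y => ?_)
          simp only [Pi.mul_apply, id, ← hrel]
          ring
        rw [h4.deriv]
        simp
      have h1 : (z - a) * deriv (dslope h a) z = deriv h z - dslope h a z := by rw [hd]; ring
      have h2 := congrArg norm h1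
      rw [norm_mul] at h2
      have h3 := norm_sub_le (deriv h z) (dslope h a z)
      have h4 := hbg z hz
      have h5 : ‖deriv (dslope h a) z‖ ≤ (‖deriv h z‖ + A * (‖h z‖ + 1)) / ρ := by
        rw [le_div_iff₀ hρ0]
        nlinarith [norm_nonneg (deriv (dslope h a) z)]
      have h6 : (‖deriv h z‖ + A * (‖h z‖ + 1)) / ρ ≤
          (1 + A) / ρ * (‖deriv h z‖ + ‖h z‖ + 1) := by
        rw [div_mul_eq_mul_div]
        gcongr
        nlinarith [norm_nonneg (h z), norm_nonneg (deriv h z),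
          mul_nonneg hA0 (norm_nonneg (deriv h z))]
      have h7 : 0 ≤ K₂ * (‖deriv h z‖ + ‖h z‖ + 1) := by positivity
      simp only [hA']
      linarith
  refine ⟨(A + A').toNNReal, fun z hz => ⟨?_, ?_⟩⟩
  · have h1 : ‖dslope h a z‖ ≤ (A + A') * (‖h z‖ + 1) :=
      (hbg z hz).trans (by gcongr; linarith)
    rw [← ofReal_norm, ← ofReal_norm (h z)]
    refine (ENNReal.ofReal_le_ofReal h1).trans (le_of_eq ?_)
    rw [ENNReal.ofReal_mul (add_nonneg hA0 hA'0), ENNReal.ofReal_add (norm_nonneg _) zero_le_one,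
      ENNReal.ofReal_one]
    rfl
  · have h1 : ‖deriv (dslope h a) z‖ ≤ (A + A') * (‖deriv h z‖ + ‖h z‖ + 1) :=
      (hbg' z hz).trans (by gcongr; linarith)
    rw [← ofReal_norm, ← ofReal_norm (h z), ← ofReal_norm (deriv h z)]
    refine (ENNReal.ofReal_le_ofReal h1).trans (le_of_eq ?_)
    rw [ENNReal.ofReal_mul (add_nonneg hA0 hA'0),
      ENNReal.ofReal_add (add_nonneg (norm_nonneg _) (norm_nonneg _)) zero_le_one,
      ENNReal.ofReal_add (norm_nonneg _) (norm_nonneg _), ENNReal.ofReal_one]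
    rfl

theorem dirichletIntegral_lt_top_iff (μ : Measure (closedBall (0 : ℂ) 1)) (f : ℂ → ℂ) :
    dirichletIntegral μ f < ⊤ ↔
      ∫⁻ z in ball 0 1, ‖deriv f z‖ₑ ^ 2 * superharmonicWeight μ z < ⊤ := by
  have h0 : (ENNReal.ofReal Real.pi)⁻¹ ≠ 0 := by simp
  have h1 : (ENNReal.ofReal Real.pi)⁻¹ ≠ ⊤ := by simp [Real.pi_pos]
  rw [dirichletIntegral, normalizedArea, lintegral_smul_measure, smul_eq_mul]
  constructor
  · intro h
    by_contra! h2
    rw [top_le_iff.1 h2, ENNReal.mul_top h0] at h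
    exact lt_irrefl _ h
  · exact fun h => ENNReal.mul_lt_top h1.lt_top h

theorem dslope_mem_dirichletSpace (μ : Measure (closedBall (0 : ℂ) 1)) [IsFiniteMeasure μ]
    {h : ℂ → ℂ} (hh : h ∈ dirichletSpace μ) {a : ℂ} (ha : a ∈ ball (0 : ℂ) 1) :
    dslope h a ∈ dirichletSpace μ := by
  obtain ⟨hd, hfin⟩ := hh
  rw [dirichletIntegral_lt_top_iff] at hfin
  refine ⟨(Complex.differentiableOn_dslope (isOpen_ball.mem_nhds ha)).2 hd, ?_⟩
  rw [dirichletIntegral_lt_top_iff]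
  obtain ⟨K, hK⟩ := exists_norm_dslope_le hd ha
  have h1 := lintegral_sq_mul_superharmonicWeight_lt_top μ hd hfin
  -- The Poincaré statement for the constant function 1, whose derivative integral vanishes, says
  -- that U_μ is integrable.
  have h2 : ∫⁻ z in ball 0 1, superharmonicWeight μ z < ⊤ := by
    have := lintegral_sq_mul_superharmonicWeight_lt_top μ (h := fun _ => 1)
      (differentiableOn_const 1) (by simp)
    simpa using this
  have hm : AEMeasurable (superharmonicWeight μ) (volume.restrict (ball (0 : ℂ) 1)) := by
    have hg := measurable_uncurry_coe (X := closedBall (0 : ℂ) 1) measurable_greenKernel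
    have hp := measurable_uncurry_coe (X := closedBall (0 : ℂ) 1) measurable_poissonWeight
    exact (hg.lintegral_prod_left'.add hp.lintegral_prod_left').aemeasurable
  calc _ ≤ ∫⁻ z in ball 0 1, (K ^ 2 * 4 : ℝ≥0∞) *
        (‖deriv h z‖ₑ ^ 2 * superharmonicWeight μ z +
          (‖h z‖ₑ ^ 2 * superharmonicWeight μ z + superharmonicWeight μ z)) := by
        refine setLIntegral_mono' measurableSet_ball fun z hz => ?_
        -- The added 0 fits the three-term sum to the four-term square inequality.
        have h3 : ‖deriv (dslope h a) z‖ₑ ^ 2 ≤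
            (K * (‖deriv h z‖ₑ + ‖h z‖ₑ + (1 + 0))) ^ 2 := by
          gcongr
          simpa using (hK z hz).2
        rw [mul_pow] at h3
        have h4 := h3.trans (mul_le_mul_right (ENNReal.add_four_sq_le _ _ _ _) _)
        calc _ ≤ _ := mul_le_mul_left h4 _
          _ = _ := by ring
    _ < ⊤ := by
        rw [lintegral_const_mul' _ _ (by finiteness), lintegral_add_left',
          lintegral_add_right' _ hm]
        · finiteness
        · exact ((measurable_deriv h).enorm.pow_const 2).aemeasurable.mul hm

theorem dslope_mem_hardySpace {h : ℂ → ℂ} (hh : h ∈ hardySpace) {a : ℂ}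
    (ha : a ∈ ball (0 : ℂ) 1) : dslope h a ∈ hardySpace := by
  obtain ⟨hd, hfin⟩ := hh
  refine ⟨(Complex.differentiableOn_dslope (isOpen_ball.mem_nhds ha)).2 hd, ?_⟩
  obtain ⟨K, hK⟩ := exists_norm_dslope_le hd ha
  set c := (ENNReal.ofReal (2 * Real.pi))⁻¹ with hc
  set v := volume (Ioc (0 : ℝ) (2 * Real.pi)) with hv
  have hct : c ≠ ⊤ := by simp [hc, Real.pi_pos]
  have hvt : v ≠ ⊤ := measure_Ioc_lt_top.ne
  set S := ⨆ r ∈ Ioo (0 : ℝ) 1, c *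
      ∫⁻ θ in Ioc (0 : ℝ) (2 * Real.pi), ‖h (r * Complex.exp (θ * Complex.I))‖ₑ ^ 2 with hS
  have hle : ∀ r ∈ Ioo (0 : ℝ) 1, c * ∫⁻ θ in Ioc (0 : ℝ) (2 * Real.pi),
      ‖dslope h a (r * Complex.exp (θ * Complex.I))‖ₑ ^ 2 ≤ K ^ 2 * 2 * (S + c * v) := by
    intro r hr
    have h1 : ∫⁻ θ in Ioc (0 : ℝ) (2 * Real.pi),
        ‖dslope h a (r * Complex.exp (θ * Complex.I))‖ₑ ^ 2 ≤ K ^ 2 * 2 *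
        ((∫⁻ θ in Ioc (0 : ℝ) (2 * Real.pi), ‖h (r * Complex.exp (θ * Complex.I))‖ₑ ^ 2) +
          v) := by
      calc _ ≤ ∫⁻ θ in Ioc (0 : ℝ) (2 * Real.pi),
            (K ^ 2 * 2 : ℝ≥0∞) * (‖h (r * Complex.exp (θ * Complex.I))‖ₑ ^ 2 + 1) := by
            refine lintegral_mono fun θ => ?_
            have hz : (r * Complex.exp (θ * Complex.I) : ℂ) ∈ ball (0 : ℂ) 1 := by
              rw [mem_ball, dist_zero_right, norm_mul, Complex.norm_exp_ofReal_mul_I, mul_one,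
                Complex.norm_real, Real.norm_of_nonneg hr.1.le]
              exact hr.2
            have h2 := pow_le_pow_left' (hK _ hz).1 2
            rw [mul_pow] at h2
            have h3 := h2.trans (mul_le_mul_right (ENNReal.add_sq_le_two_mul _ _) _)
            rw [one_pow, ← mul_assoc] at h3
            exact h3
        _ = _ := by
            rw [lintegral_const_mul' _ _ (by finiteness), lintegral_add_right _ measurable_const,
              lintegral_const, Measure.restrict_apply_univ, one_mul]
    calc _ ≤ _ := mul_le_mul_right h1 c
      _ = K ^ 2 * 2 * (c * (∫⁻ θ in Ioc (0 : ℝ) (2 * Real.pi),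
            ‖h (r * Complex.exp (θ * Complex.I))‖ₑ ^ 2) + c * v) := by ring
      _ ≤ _ := by
        gcongr
        exact le_iSup₂_of_le (f := fun (r : ℝ) (_ : r ∈ Ioo (0 : ℝ) 1) => c *
          ∫⁻ θ in Ioc (0 : ℝ) (2 * Real.pi), ‖h (r * Complex.exp (θ * Complex.I))‖ₑ ^ 2)
          r hr le_rfl
  refine (iSup₂_le hle).trans_lt ?_
  have := hfin.ne
  finiteness

theorem mainTheorem11 (μ : Measure (closedBall (0 : ℂ) 1)) [IsFiniteMeasure μ] :
    HasGleasonProperty (dirichletSpace μ) ∧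
      HasGleasonProperty (dirichletSpace μ ∩ hardySpace) := by
  have hrel : ∀ (h : ℂ → ℂ) (a : ℂ), ∀ z ∈ ball (0 : ℂ) 1,
      h z - h a = (z - a) * dslope h a z := fun h a z _ => by
    simpa using (sub_smul_dslope h a z).symm
  exact ⟨fun h hh a ha => ⟨dslope h a, dslope_mem_dirichletSpace μ hh ha, hrel h a⟩,
    fun h hh a ha => ⟨dslope h a,
      ⟨dslope_mem_dirichletSpace μ hh.1 ha, dslope_mem_hardySpace hh.2 ha⟩, hrel h a⟩⟩
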